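/- A broadcast network $\mathcal N=(D,P)$ consists of a finite set $D$ of messages and a client automaton $P=(Q,I,\delta)$ with a finite set $Q$ of states, initial states $I\subseteq Q$ and a transition relation $\delta\subseteq Q\times\{!a,?a : a\in D\}\times Q$. A configuration with $k\in\mathbb N$ clients is a tuple $c\in Q^k$; it is initial if $c\in I^k$. A transition $c\xrightarrow{a}c'$ between configurations with $k$ clients is given by a message $a\in D$, a sender $i\in\{1,\dots,k\}$ and a set of receivers $R\subseteq\{1,\dots,k\}\setminus\{i\}$ such that $(c[i],!a,c'[i])\in\delta$, $(c[j],?a,c'[j])\in\delta$ for all $j\in R$, and $c'[j]=c[j]$ for all $j\notin R\cup\{i\}$; the clients in $R\cup\{i\}$ participate in the transition. For an infinite computation $\pi=c_0\to c_1\to\cdots$, let $\mathrm{Inf}(\pi)$ be the set of clients that participate in infinitely many of its transitions and, for $F\subseteq Q$, let $\mathrm{Fin}(\pi)$ be the set of clients $i$ with $c_t[i]\in F$ for infinitely many $t$. The computation is initialized if $c_0$ is initial. Fair liveness verification is the following decision problem. Input: a broadcast network $\mathcal N=(D,P)$ and a set of final states $F\subseteq Q$. Question: is there, for some number $k$ of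 clients, an initialized infinite computation $\pi$ of $\mathcal N$ with $\mathrm{Inf}(\pi)\subseteq\mathrm{Fin}(\pi)$? Theorem. Fair liveness verification is in $\mathsf P$: there is a (multi-stack) Turing machine that decides it in a number of steps bounded by a polynomial in the length of the encoded input. Here the input, with $D=\{0,\dots,d-1\}$ and $Q=\{0,\dots,n-1\}$, is encoded as a bit string that consists of $n$, $d$ and explicit lists of the initial states, the final states and the transitions, all numbers being written in unary (so the length is at least $|Q|+|D|$, and polynomial in $|Q|$, $|D|$ and the lengths of the lists). -/

import Mathlib

namespace BroadcastNet

/-- The communication operations over a message domain `D`: sending `!a` and receiving `?a`. -/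
inductive Op (D : Type*) where
  | send (a : D)
  | recv (a : D)

/-- A broadcast network with message domain `D`; its identical clients are the automaton with
state set `Q`, initial states `init` and transition relation `trans`. -/
structure Network (D Q : Type*) where
  init : Set Q
  trans : Set (Q × Op D × Q)

namespace Network

variable {D Q : Type*}

/-- The transition `c → c'` of the `k`-client system on message `a`: client `i` sends `a`,
the clients in `R` (a set not containing `i`) receive `a`, all other clients stay idle. -/
def Step (N : Network D Q) {k : ℕ} (c : Fin k → Q) (a : D) (i : Fin k) (R : Finset (Fin k))
    (c' : Fin k → Q) : Prop :=
  i ∉ R ∧ (c i, Op.send a, c' i) ∈ N.trans ∧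
    (∀ j ∈ R, (c j, Op.recv a, c' j) ∈ N.trans) ∧
    ∀ j, j ≠ i → j ∉ R → c' j = c j

/-- An infinite computation with `k` clients. Each transition comes with its message, its sender
and its set of receivers. -/
structure InfComputation (N : Network D Q) (k : ℕ) where
  config : ℕ → Fin k → Q
  msg : ℕ → D
  sender : ℕ → Fin k
  receivers : ℕ → Finset (Fin k)
  step : ∀ t, N.Step (config t) (msg t) (sender t) (receivers t) (config (t + 1))

namespace InfComputation

variable {N : Network D Q} {k : ℕ}

/-- All clients start in an initial state. -/
def Initialized (π : N.InfComputation k) : Prop :=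
  ∀ i, π.config 0 i ∈ N.init

/-- The clients that contribute to the `t`-th transition. -/
def participants (π : N.InfComputation k) (t : ℕ) : Finset (Fin k) :=
  insert (π.sender t) (π.receivers t)

/-- `Inf(π)`: the clients that participate infinitely often. -/
def infSet (π : N.InfComputation k) : Set (Fin k) :=
  {i | ∃ᶠ t in Filter.atTop, i ∈ π.participants t}

/-- `Fin(π)`: the clients that visit a state in `F` infinitely often. -/
def finSet (π : N.InfComputation k) (F : Set Q) : Set (Fin k) :=
  {i | ∃ᶠ t in Filter.atTop, π.config t i ∈ F}

end InfComputation

/-- For some number of clients there is an initialized infinite computation in which every client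
that participates infinitely often visits `F` infinitely often. -/
def HasFairComputation (N : Network D Q) (F : Set Q) : Prop :=
  ∃ (k : ℕ) (π : N.InfComputation k), π.Initialized ∧ π.infSet ⊆ π.finSet F

end Network

/-- An input of fair liveness verification as finite data: a network with messages
`0, …, numMsgs - 1` and states `0, …, numStates - 1`, whose initial states, final states and
transitions are listed explicitly. -/
structure Instance where
  numStates : ℕ
  numMsgs : ℕ
  initial : List (Fin numStates)
  final : List (Fin numStates)
  transitions : List (Fin numStates × Op (Fin numMsgs) × Fin numStates)

namespace Instance

def network (x : Instance) : Network (Fin x.numMsgs) (Fin x.numStates) where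
  init := {q | q ∈ x.initial}
  trans := {τ | τ ∈ x.transitions}

def finalStates (x : Instance) : Set (Fin x.numStates) :=
  {q | q ∈ x.final}

/-- The question of fair liveness verification. -/
def FairLive (x : Instance) : Prop :=
  x.network.HasFairComputation x.finalStates

/-- The number `n` is written as `1ⁿ0`. -/
def encodeNum (n : ℕ) : List Bool :=
  List.replicate n true ++ [false]

def encodeFin {n : ℕ} (q : Fin n) : List Bool :=
  encodeNum q

/-- A list is written as its items, each preceded by a `1`, followed by a `0`. -/
def encodeItems {α : Type*} (e : α → List Bool) (l : List α) : List Bool :=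
  l.flatMap (fun x => true :: e x) ++ [false]

/-- `!a` is written as `1` and then `a`, and `?a` is written as `0` and then `a`. -/
def encodeOp {d : ℕ} : Op (Fin d) → List Bool
  | Op.send a => true :: encodeFin a
  | Op.recv a => false :: encodeFin a

def encodeTrans {n d : ℕ} (τ : Fin n × Op (Fin d) × Fin n) : List Bool :=
  encodeFin τ.1 ++ encodeOp τ.2.1 ++ encodeFin τ.2.2

/-- The bit string that presents an instance to a machine. As the number of states and the number
of messages are written in unary, its length is at least `|Q| + |D|`. -/
def encode (x : Instance) : List Bool :=
  encodeNum x.numStates ++ encodeNum x.numMsgs ++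
    encodeItems encodeFin x.initial ++
    encodeItems encodeFin x.final ++
    encodeItems encodeTrans x.transitions

/-- `e` is an injective prefix code. -/
def IsPrefixCode {α : Type*} (e : α → List Bool) : Prop :=
  ∀ x y u v, e x ++ u = e y ++ v → x = y ∧ u = v

theorem isPrefixCode_encodeNum : IsPrefixCode encodeNum := by
  intro x
  induction x with
  | zero =>
    intro y u v h
    cases y with
    | zero => simpa [encodeNum] using h
    | succ y => simp [encodeNum, List.replicate_succ] at h
  | succ x ih =>
    intro y u v h
    cases y with
    | zero => simp [encodeNum, List.replicate_succ] at h
    | succ y =>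
      have := ih y u v (by simpa [encodeNum, List.replicate_succ] using h)
      simpa using this

theorem isPrefixCode_encodeFin (n : ℕ) : IsPrefixCode (encodeFin : Fin n → List Bool) := by
  intro x y u v h
  obtain ⟨h1, h2⟩ := isPrefixCode_encodeNum _ _ _ _ h
  exact ⟨Fin.ext h1, h2⟩

theorem isPrefixCode_encodeItems {α : Type*} {e : α → List Bool} (he : IsPrefixCode e) :
    IsPrefixCode (encodeItems e) := by
  intro x
  induction x with
  | nil =>
    intro y u v h
    cases y with
    | nil => simpa [encodeItems] using h
    | cons b y => simp [encodeItems] at h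
  | cons a x ih =>
    intro y u v h
    cases y with
    | nil => simp [encodeItems] at h
    | cons b y =>
      simp only [encodeItems, List.flatMap_cons, List.cons_append, List.append_assoc,
        List.cons.injEq, true_and] at h
      obtain ⟨rfl, h'⟩ := he _ _ _ _ h
      have := ih y u v (by simpa [encodeItems] using h')
      simpa using this

theorem isPrefixCode_encodeTrans (n d : ℕ) :
    IsPrefixCode (encodeTrans : Fin n × Op (Fin d) × Fin n → List Bool) := by
  rintro ⟨p, o, q⟩ ⟨p', o', q'⟩ u v h
  simp only [encodeTrans, List.append_assoc] at h
  obtain ⟨e1, h1⟩ := isPrefixCode_encodeFin n _ _ _ _ h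
  cases o <;> cases o' <;> simp [encodeOp] at h1
  all_goals
    obtain ⟨e2, h2⟩ := isPrefixCode_encodeFin d _ _ _ _ h1
    obtain ⟨e3, h3⟩ := isPrefixCode_encodeFin n _ _ _ _ h2
    exact ⟨by rw [e1, e2, e3], h3⟩

/-- Distinct instances have distinct encodings. -/
theorem encode_injective : Function.Injective encode := by
  rintro ⟨n, d, I, F, T⟩ ⟨n', d', I', F', T'⟩ h
  simp only [encode, List.append_assoc] at h
  obtain ⟨e1, h1⟩ := isPrefixCode_encodeNum _ _ _ _ h
  obtain ⟨e2, h2⟩ := isPrefixCode_encodeNum _ _ _ _ h1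
  subst e1 e2
  obtain ⟨e3, h3⟩ := isPrefixCode_encodeItems (isPrefixCode_encodeFin n) _ _ _ _ h2
  obtain ⟨e4, h4⟩ := isPrefixCode_encodeItems (isPrefixCode_encodeFin n) _ _ _ _ h3
  obtain ⟨e5, -⟩ := isPrefixCode_encodeItems (isPrefixCode_encodeTrans n d) T T' [] []
    (by simpa using h4)
  rw [e3, e4, e5]

end Instance

/-- The decision problem `p` on inputs of type `α`, presented through `enc`, is in P: a multi-stack
Turing machine decides it in a number of steps polynomial in the length of the encoded input. -/
def DecidableInPolyTime {α : Type} (enc : α → List Bool) (p : α → Prop) : Prop :=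
  ∃ f : α → Bool, (∀ x, f x = true ↔ p x) ∧
    Nonempty (Turing.TM2ComputableInPolyTime enc Computability.encodeBool f)

end BroadcastNet

/-! Combinatorics. A fair computation exists if and only if there is a nonempty sustainable set of
transitions: their sources are reachable, each receive is matched by a send of the same message in
the set, and each transition lies on a closed walk inside the set that meets `F`
(`Network.hasFairComputation_iff`). Given a fair computation, the transitions that some fixed client
takes infinitely often form such a set: a client that takes one of them infinitely often also visits
`F` in between, and from some time on it takes only transitions of the set
(`InfComputation.sustainable_recurrent`).

Conversely, choose for every transition of the set a closed walk through it and through `F`, and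
place one client at every position of every walk. In one round all these clients advance by one
position: each send position gets a phase, and each receive position joins the phase of some send of
its message. Afterwards every position is occupied again, so rounds repeat forever and every moving
client passes `F` infinitely often (`Carousel.fairFrom`). The starting configuration can be
produced, up to additional clients that then stay idle, because clients can be multiplied at will:
any finite family of reachable states is covered by some reachable configuration
(`coverable_of_reachable`).

Algorithm. Reachable states are a least fixed point. After the transitions with unreachable sources
are deleted, those that violate the send or the cycle condition are deleted repeatedly; a
sustainable set survives all deletions, and what remains when deletion stalls is sustainable. Each
fixed point is reached after polynomially many rounds (`subset_of_chain`), so loops of fixed length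
suffice.

Complexity. The machine is obtained by two verified compilations. Table programs have variables in
`Fin L`, ternary bit tables and loops of exactly `L` rounds, where `L` is the input length. They are
translated to loop programs on stacks (`TableProg.run_compile`), and these to multi-stack machines
with an explicit polynomial time bound (`LoopProg.reachesIn_code`). Every such program is polynomial
by its syntax, so it only remains to program the parser and the search as table programs and prove
them correct. -/

open Turing Function

/-! ### Loop programs and their translation to machine code. -/

/-- Structured programs on finitely many contents of bits with a finite control state. The body of
a `loop` is always executed as many times as the input of the program is long. -/
inductive LoopProg (K σ : Type)
  | load (f : σ → σ)
  | push (k : K) (f : σ → Bool)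
  | pop (k : K) (f : σ → Option Bool → σ)
  | peek (k : K) (f : σ → Option Bool → σ)
  | seq (p q : LoopProg K σ)
  | ite (c : σ → Bool) (p q : LoopProg K σ)
  | loop (p : LoopProg K σ)

namespace LoopProg

variable {K σ : Type} [DecidableEq K]

/-- The semantics of a program for inputs of length `L`. -/
def run (L : ℕ) : LoopProg K σ → σ × (K → List Bool) → σ × (K → List Bool)
  | load f => fun s => (f s.1, s.2)
  | push k f => fun s => (s.1, update s.2 k (f s.1 :: s.2 k))
  | pop k f => fun s => (f s.1 (s.2 k).head?, update s.2 k (s.2 k).tail)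
  | peek k f => fun s => (f s.1 (s.2 k).head?, s.2)
  | seq p q => fun s => run L q (run L p s)
  | ite c p q => fun s => bif c s.1 then run L p s else run L q s
  | loop p => (run L p)^[L]

open Polynomial in
/-- A bound on the number of machine steps, as a polynomial in the length of the input. -/
noncomputable def time : LoopProg K σ → ℕ[X]
  | load _ => 1
  | push _ _ => 1
  | pop _ _ => 1
  | peek _ _ => 1
  | seq p q => time p + time q
  | ite _ p q => 1 + time p + time q
  | loop p => X * (time p + 2) + 2

/-- An instruction of cost one adds at most one element to a stack, so the time bound also bounds
the growth of the stacks. This limits the cost of emptying them before halting. -/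
theorem length_run_le (L : ℕ) (p : LoopProg K σ) (s : σ × (K → List Bool)) (k : K) :
    ((run L p s).2 k).length ≤ (s.2 k).length + (time p).eval L := by
  induction p generalizing s with
  | load f => simp [run]
  | push k' f =>
    by_cases h : k = k'
    · subst h; simp [run, time]
    · simp [run, update_of_ne h]
  | pop k' f =>
    by_cases h : k = k'
    · subst h; simp [run, time]; omega
    · simp [run, update_of_ne h]
  | peek k' f => simp [run]
  | seq p q hp hq =>
    have h1 := hp s
    have h2 := hq (run L p s)
    simp only [run, time, Polynomial.eval_add]
    omega
  | ite c p q hp hq =>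
    have h1 := hp s
    have h2 := hq s
    simp only [run, time, Polynomial.eval_add]
    cases c s.1 <;> simp only [cond_true, cond_false] <;> omega
  | loop p hp =>
    have key : ∀ n, (((run L p)^[n] s).2 k).length ≤ (s.2 k).length + n * (time p).eval L := by
      intro n
      induction n with
      | zero => simp
      | succ n ih =>
        have := hp ((run L p)^[n] s)
        rw [iterate_succ_apply', add_one_mul]
        omega
    have := key L
    simp only [run, time, Polynomial.eval_add, Polynomial.eval_mul, Polynomial.eval_X,
      Polynomial.eval_ofNat]
    nlinarith

/-- The labels of the machine code of a program. -/
def Lab : LoopProg K σ → Type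
  | load _ => Unit
  | push _ _ => Unit
  | pop _ _ => Unit
  | peek _ _ => Unit
  | seq p q => Lab p ⊕ Lab q
  | ite _ p q => Option (Lab p ⊕ Lab q)
  | loop p => Bool ⊕ Lab p

noncomputable instance : ∀ p : LoopProg K σ, Fintype (Lab p)
  | load _ => inferInstanceAs (Fintype Unit)
  | push _ _ => inferInstanceAs (Fintype Unit)
  | pop _ _ => inferInstanceAs (Fintype Unit)
  | peek _ _ => inferInstanceAs (Fintype Unit)
  | seq p q =>
    have := instFintypeLab p
    have := instFintypeLab q
    inferInstanceAs (Fintype (Lab p ⊕ Lab q))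
  | ite _ p q =>
    have := instFintypeLab p
    have := instFintypeLab q
    inferInstanceAs (Fintype (Option (Lab p ⊕ Lab q)))
  | loop p =>
    have := instFintypeLab p
    inferInstanceAs (Fintype (Bool ⊕ Lab p))

/-- The label at which the machine code of a program starts. -/
def entry : (p : LoopProg K σ) → Lab p
  | load _ => ()
  | push _ _ => ()
  | pop _ _ => ()
  | peek _ _ => ()
  | seq p _ => Sum.inl (entry p)
  | ite _ _ _ => none
  | loop _ => Sum.inl false

/-- The contents of the machine: input, output, the contents of the program, and a pair of clock
contents for every label. -/
inductive Stk (K Λ : Type)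
  | input
  | output
  | data (k : K)
  | todo (l : Λ)
  | done (l : Λ)
  deriving DecidableEq, Fintype

abbrev Code (K σ Λ : Type) := TM2.Stmt (fun _ : Stk K Λ => Bool) Λ (σ × Option Bool)

open TM2.Stmt in
/-- The code at the head of a loop with clock `c`: advance the clock and go to `body`, or go to
`rewind` if the clock has run down. -/
def headCode {Λ : Type} (c body rewind : Λ) : Code K σ Λ :=
  .pop (.todo c) (fun v o => (v.1, o))
    (branch (fun v => v.2.isSome)
      (.push (.done c) (fun _ => true) (.load (fun v => (v.1, none)) (goto fun _ => body)))
      (goto fun _ => rewind))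

open TM2.Stmt in
/-- The code at label `self` that rewinds clock `c` and then goes to `exit`. -/
def rewindCode {Λ : Type} (c self exit : Λ) : Code K σ Λ :=
  .pop (.done c) (fun v o => (v.1, o))
    (branch (fun v => v.2.isSome)
      (.push (.todo c) (fun _ => true) (.load (fun v => (v.1, none)) (goto fun _ => self)))
      (goto fun _ => exit))

open TM2.Stmt in
/-- The machine code of a program. -/
def code {Λ : Type} : (p : LoopProg K σ) → (Lab p → Λ) → Λ → Lab p → Code K σ Λ
  | load f, _, exit, _ => .load (fun v => (f v.1, v.2)) (goto fun _ => exit)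
  | push k f, _, exit, _ => .push (.data k) (fun v => f v.1) (goto fun _ => exit)
  | pop k f, _, exit, _ => .pop (.data k) (fun v o => (f v.1 o, v.2)) (goto fun _ => exit)
  | peek k f, _, exit, _ => .peek (.data k) (fun v o => (f v.1 o, v.2)) (goto fun _ => exit)
  | seq p q, emb, exit, l =>
    match l with
    | .inl l => code p (fun l => emb (.inl l)) (emb (.inr (entry q))) l
    | .inr l => code q (fun l => emb (.inr l)) exit l
  | ite c p q, emb, exit, l =>
    match l with
    | none => goto fun v =>
        bif c v.1 then emb (some (.inl (entry p))) else emb (some (.inr (entry q)))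
    | some (.inl l) => code p (fun l => emb (some (.inl l))) exit l
    | some (.inr l) => code q (fun l => emb (some (.inr l))) exit l
  | loop p, emb, exit, l =>
    match l with
    | .inl false => headCode (emb (.inl false)) (emb (.inr (entry p))) (emb (.inl true))
    | .inl true => rewindCode (emb (.inl false)) (emb (.inl true)) exit
    | .inr l => code p (fun l => emb (.inr l)) (emb (.inl false)) l

/-- `b` is reached from `a` in at most `n` steps. -/
def ReachesIn {C : Type} (f : C → Option C) (n : ℕ) (a b : C) : Prop :=
  ∃ m ≤ n, (flip bind f)^[m] (some a) = some b

namespace ReachesIn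

variable {C : Type} {f : C → Option C} {m n : ℕ} {a b c : C}

theorem refl (f : C → Option C) (n : ℕ) (a : C) : ReachesIn f n a a :=
  ⟨0, Nat.zero_le _, rfl⟩

theorem trans (h₁ : ReachesIn f m a b) (h₂ : ReachesIn f n b c) : ReachesIn f (m + n) a c := by
  obtain ⟨i, hi, h₁⟩ := h₁
  obtain ⟨j, hj, h₂⟩ := h₂
  exact ⟨j + i, by omega, by rw [iterate_add_apply, h₁, h₂]⟩

theorem mono (h : ReachesIn f m a b) (hmn : m ≤ n) : ReachesIn f n a b := by
  obtain ⟨i, hi, h⟩ := h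
  exact ⟨i, hi.trans hmn, h⟩

theorem single (h : f a = some b) : ReachesIn f 1 a b :=
  ⟨1, le_rfl, h⟩

theorem iterate (g : ℕ → C) (N : ℕ) (h : ∀ i < N, ReachesIn f m (g i) (g (i + 1))) :
    ReachesIn f (N * m) (g 0) (g N) := by
  induction N with
  | zero => exact refl _ _ _
  | succ N ih =>
    rw [add_one_mul]
    exact (ih fun i hi => h i (by omega)).trans (h N (by omega))

end ReachesIn

/-- The contents of the machine's stacks during the execution of a program. -/
def contents {Λ : Type} (d : K → List Bool) (td dn : Λ → List Bool) : Stk K Λ → List Bool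
  | .input => []
  | .output => []
  | .data k => d k
  | .todo l => td l
  | .done l => dn l

section contents

variable {Λ : Type} [DecidableEq Λ] (d : K → List Bool) (td dn : Λ → List Bool)

theorem update_contents_data (k : K) (x : List Bool) :
    update (contents d td dn) (.data k) x = contents (update d k x) td dn := by
  funext j; cases j <;> simp [contents, update_apply]

theorem update_contents_todo (l : Λ) (x : List Bool) :
    update (contents d td dn) (.todo l) x = contents d (update td l x) dn := by
  funext j; cases j <;> simp [contents, update_apply]

theorem update_contents_done (l : Λ) (x : List Bool) :
    update (contents d td dn) (.done l) x = contents d td (update dn l x) := by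
  funext j; cases j <;> simp [contents, update_apply]

end contents

/-- The configuration at label `l` during the execution of a program. -/
def cfg {Λ : Type} (l : Λ) (s : σ × (K → List Bool)) (td dn : Λ → List Bool) :
    TM2.Cfg (fun _ : Stk K Λ => Bool) Λ (σ × Option Bool) :=
  ⟨some l, (s.1, none), contents s.2 td dn⟩

theorem reachesIn_headCode_succ {Λ : Type} [DecidableEq Λ] {M : Λ → Code K σ Λ} {c b r : Λ}
    (h : M c = headCode c b r) (s : σ × (K → List Bool)) (td dn : Λ → List Bool) (i j : ℕ) :
    ReachesIn (TM2.step M) 1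
      (cfg c s (update td c (List.replicate (j + 1) true)) (update dn c (List.replicate i true)))
      (cfg b s (update td c (List.replicate j true))
        (update dn c (List.replicate (i + 1) true))) := by
  refine .single ?_
  simp only [cfg, TM2.step, h, headCode, TM2.stepAux, contents, update_contents_todo,
    update_contents_done]
  simp [List.replicate_succ]

theorem reachesIn_headCode_zero {Λ : Type} [DecidableEq Λ] {M : Λ → Code K σ Λ} {c b r : Λ}
    (h : M c = headCode c b r) (s : σ × (K → List Bool)) (td dn : Λ → List Bool) :
    ReachesIn (TM2.step M) 1 (cfg c s (update td c []) dn) (cfg r s (update td c []) dn) := by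
  refine .single ?_
  simp only [cfg, TM2.step, h, headCode, TM2.stepAux, contents, update_contents_todo]
  simp

theorem reachesIn_rewindCode_succ {Λ : Type} [DecidableEq Λ] {M : Λ → Code K σ Λ} {c r e : Λ}
    (h : M r = rewindCode c r e) (s : σ × (K → List Bool)) (td dn : Λ → List Bool) (i j : ℕ) :
    ReachesIn (TM2.step M) 1
      (cfg r s (update td c (List.replicate i true)) (update dn c (List.replicate (j + 1) true)))
      (cfg r s (update td c (List.replicate (i + 1) true))
        (update dn c (List.replicate j true))) := by
  refine .single ?_
  simp only [cfg, TM2.step, h, rewindCode, TM2.stepAux, contents, update_contents_todo,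
    update_contents_done]
  simp [List.replicate_succ]

theorem reachesIn_rewindCode_zero {Λ : Type} [DecidableEq Λ] {M : Λ → Code K σ Λ} {c r e : Λ}
    (h : M r = rewindCode c r e) (s : σ × (K → List Bool)) (td dn : Λ → List Bool) :
    ReachesIn (TM2.step M) 1 (cfg r s td (update dn c [])) (cfg e s td (update dn c [])) := by
  refine .single ?_
  simp only [cfg, TM2.step, h, rewindCode, TM2.stepAux, contents, update_contents_done]
  simp

/-- The clock contents are arbitrary except at the labels of the program itself, because inside a
loop the clock of the enclosing loop is partly run down. Injectivity of `emb` keeps the clocks of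
nested loops apart. A loop rewinds its clock before it exits, so it can be entered again. -/
theorem reachesIn_code {Λ : Type} [DecidableEq Λ] (M : Λ → Code K σ Λ) (L : ℕ)
    (p : LoopProg K σ) (emb : Lab p → Λ) (hemb : Injective emb) (exit : Λ)
    (hM : ∀ l, M (emb l) = code p emb exit l) (td dn : Λ → List Bool)
    (htd : ∀ l, td (emb l) = List.replicate L true) (hdn : ∀ l, dn (emb l) = [])
    (s : σ × (K → List Bool)) :
    ReachesIn (TM2.step M) ((time p).eval L) (cfg (emb (entry p)) s td dn)
      (cfg exit (run L p s) td dn) := by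
  induction p generalizing exit td dn s with
  | load f =>
    simp only [time, Polynomial.eval_one]
    exact .single (by simp [cfg, TM2.step, hM, code, run])
  | push k f =>
    simp only [time, Polynomial.eval_one]
    exact .single (by simp [cfg, TM2.step, hM, code, run, update_contents_data]; rfl)
  | pop k f =>
    simp only [time, Polynomial.eval_one]
    exact .single (by simp [cfg, TM2.step, hM, code, run, update_contents_data]; exact ⟨rfl, rfl⟩)
  | peek k f =>
    simp only [time, Polynomial.eval_one]
    exact .single (by simp [cfg, TM2.step, hM, code, run]; rfl)
  | seq p q hp hq =>
    simp only [time, Polynomial.eval_add]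
    refine ReachesIn.trans (hp (fun l => emb (.inl l)) (fun a b h => Sum.inl.inj (hemb h)) _
      (fun l => hM (.inl l)) td dn (fun l => htd (.inl l)) (fun l => hdn (.inl l)) s) ?_
    exact hq (fun l => emb (.inr l)) (fun a b h => Sum.inr.inj (hemb h)) _
      (fun l => hM (.inr l)) td dn (fun l => htd (.inr l)) (fun l => hdn (.inr l)) _
  | ite c p q hp hq =>
    simp only [time, Polynomial.eval_add, Polynomial.eval_one]
    have step : TM2.step M (cfg (emb none) s td dn) = some (cfg (bif c s.1 then
        emb (some (.inl (entry p))) else emb (some (.inr (entry q)))) s td dn) := by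
      simp only [cfg, TM2.step]
      rw [show M (emb none) = _ from hM none]
      simp [code]
    simp only [run]
    cases hc : c s.1 with
    | true =>
      simp only [hc, cond_true] at step ⊢
      refine ReachesIn.mono (ReachesIn.trans (.single step) (hp (fun l => emb (some (.inl l)))
        (fun a b h => Sum.inl.inj (Option.some.inj (hemb h))) exit (fun l => hM (some (.inl l)))
        td dn (fun l => htd (some (.inl l))) (fun l => hdn (some (.inl l))) s)) ?_
      omega
    | false =>
      simp only [hc, cond_false] at step ⊢
      refine ReachesIn.mono (ReachesIn.trans (.single step) (hq (fun l => emb (some (.inr l)))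
        (fun a b h => Sum.inr.inj (Option.some.inj (hemb h))) exit (fun l => hM (some (.inr l)))
        td dn (fun l => htd (some (.inr l))) (fun l => hdn (some (.inr l))) s)) ?_
      omega
  | loop p hp =>
    have hne : ∀ l : Lab p, emb (.inr l) ≠ emb (.inl false) := fun l h => by
      simpa using hemb h
    have hc : M (emb (.inl false)) =
      headCode (emb (.inl false)) (emb (.inr (entry p))) (emb (.inl true)) := hM _
    have hr : M (emb (.inl true)) =
      rewindCode (emb (.inl false)) (emb (.inl true)) exit := hM _
    have hb : ∀ l, M (emb (.inr l)) = code p (fun l => emb (.inr l)) (emb (.inl false)) l :=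
      fun l => hM (.inr l)
    have htc := htd (.inl false)
    have hdc := hdn (.inl false)
    rw [show entry (loop p) = .inl false from rfl]
    generalize emb (.inl false) = c at *
    generalize emb (.inl true) = r at *
    -- After `i` rounds, `L - i` ticks of the clock of this loop are left and `i` are used up.
    -- Rewinding passes through the same clock states in reverse order.
    let tdn : ℕ → Λ → List Bool := fun i => update td c (List.replicate (L - i) true)
    let dnn : ℕ → Λ → List Bool := fun i => update dn c (List.replicate i true)
    have body : ∀ i < L, ReachesIn (TM2.step M) ((time p).eval L + 1)
        (cfg c ((run L p)^[i] s) (tdn i) (dnn i))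
        (cfg c ((run L p)^[i + 1] s) (tdn (i + 1)) (dnn (i + 1))) := by
      intro i hi
      rw [add_comm, iterate_succ_apply']
      refine ReachesIn.trans (b := cfg (emb (.inr (entry p))) ((run L p)^[i] s) (tdn (i + 1))
        (dnn (i + 1))) ?_ (hp (fun l => emb (.inr l)) (fun a b h => Sum.inr.inj (hemb h)) c
        hb (tdn (i + 1)) (dnn (i + 1)) (fun l => ?_) (fun l => ?_) _)
      · obtain ⟨j, hj⟩ : ∃ j, L - i = j + 1 := ⟨L - i - 1, by omega⟩
        have hj' : L - (i + 1) = j := by omega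
        simp only [tdn, dnn, hj, hj']
        exact reachesIn_headCode_succ hc _ _ _ _ _
      · simp only [tdn]
        rw [update_of_ne (hne l)]
        exact htd (.inr l)
      · simp only [dnn]
        rw [update_of_ne (hne l)]
        exact hdn (.inr l)
    have back : ∀ i < L, ReachesIn (TM2.step M) 1
        (cfg r ((run L p)^[L] s) (tdn (L - i)) (dnn (L - i)))
        (cfg r ((run L p)^[L] s) (tdn (L - (i + 1))) (dnn (L - (i + 1)))) := by
      intro i hi
      obtain ⟨j, hj⟩ : ∃ j, L - i = j + 1 := ⟨L - i - 1, by omega⟩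
      have hj' : L - (i + 1) = j := by omega
      have e : L - j = (L - (j + 1)) + 1 := by omega
      simp only [tdn, dnn, hj, hj', e]
      exact reachesIn_rewindCode_succ hr _ _ _ _ _
    have h0 : tdn 0 = td := by
      simp only [tdn, Nat.sub_zero]
      rw [← htc, update_eq_self]
    have h0' : dnn 0 = dn := by
      simp only [dnn, List.replicate_zero]
      rw [← hdc, update_eq_self]
    have r1 := ReachesIn.iterate
      (fun i => cfg (K := K) c ((run L p)^[i] s) (tdn i) (dnn i)) L body
    have r2 : ReachesIn (TM2.step M) 1 (cfg c ((run L p)^[L] s) (tdn L) (dnn L))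
        (cfg r ((run L p)^[L] s) (tdn L) (dnn L)) := by
      simp only [tdn, Nat.sub_self, List.replicate_zero]
      exact reachesIn_headCode_zero hc _ _ _
    have r3 := ReachesIn.iterate
      (fun i => cfg (K := K) r ((run L p)^[L] s) (tdn (L - i)) (dnn (L - i))) L back
    have r4 : ReachesIn (TM2.step M) 1 (cfg r ((run L p)^[L] s) td (dnn 0))
        (cfg exit ((run L p)^[L] s) td (dnn 0)) :=
      reachesIn_rewindCode_zero hr _ _ _
    simp only [h0, h0', Nat.sub_zero, Nat.sub_self, iterate_zero_apply] at r1 r3 r4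
    refine (((r1.trans r2).trans r3).trans r4).mono ?_
    simp only [time, Polynomial.eval_add, Polynomial.eval_mul, Polynomial.eval_X,
      Polynomial.eval_ofNat]
    apply le_of_eq
    ring

/-! ### The whole machine: reading the input, running the program, cleaning up. -/

section machine

open TM2.Stmt

variable {Λ : Type} [DecidableEq Λ]

/-- Push a tick onto each of the clocks in a list. -/
def pushTicks (ls : List Λ) (q : Code K σ Λ) : Code K σ Λ :=
  ls.foldr (fun l q => .push (.todo l) (fun _ => true) q) q

theorem stepAux_pushTicks (ls : List Λ) (q : Code K σ Λ) (v : σ × Option Bool)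
    (i : List Bool) (d : K → List Bool) (td dn : Λ → List Bool) :
    TM2.stepAux (pushTicks ls q) v (update (contents d td dn) .input i) =
      TM2.stepAux q v (update
        (contents d (fun l => List.replicate (ls.count l) true ++ td l) dn) .input i) := by
  induction ls generalizing td with
  | nil => simp [pushTicks]
  | cons a ls ih =>
    rw [show pushTicks (a :: ls) q = .push (.todo a) (fun _ => true) (pushTicks ls q) from rfl]
    simp only [TM2.stepAux]
    rw [update_comm (by simp), update_contents_todo, ih]
    congr 3
    funext l
    by_cases h : l = a
    · subst h
      simp [contents, ← List.replicate_append_replicate]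
    · simp [update_of_ne h, List.count_cons_of_ne (Ne.symm h)]

theorem stepAux_pushTicks_univ [Fintype Λ] (q : Code K σ Λ) (v : σ × Option Bool)
    (i : List Bool) (d : K → List Bool) (td dn : Λ → List Bool) :
    TM2.stepAux (pushTicks Finset.univ.toList q) v (update (contents d td dn) .input i) =
      TM2.stepAux q v (update (contents d (fun l => true :: td l) dn) .input i) := by
  rw [stepAux_pushTicks]
  congr! 4 with l
  rw [List.count_eq_one_of_mem (Finset.nodup_toList _) (by simp)]
  rfl

/-- Pop all stacks in a list and record if one of them was nonempty. -/
def popAll (ks : List (Stk K Λ)) (q : Code K σ Λ) : Code K σ Λ :=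
  ks.foldr (fun k q => .pop k (fun v o => (v.1, bif o.isSome then some true else v.2)) q) q

theorem stepAux_popAll (ks : List (Stk K Λ)) (hks : ks.Nodup) (q : Code K σ Λ)
    (v : σ × Option Bool) (S : Stk K Λ → List Bool) :
    TM2.stepAux (popAll ks q) v S =
      TM2.stepAux q (v.1, if ∃ k ∈ ks, S k ≠ [] then some true else v.2)
        (fun k => if k ∈ ks then (S k).tail else S k) := by
  induction ks generalizing v S with
  | nil => simp [popAll]
  | cons a ks ih =>
    rw [List.nodup_cons] at hks
    rw [show popAll (a :: ks) q =
      .pop a (fun v o => (v.1, bif o.isSome then some true else v.2)) (popAll ks q) from rfl]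
    simp only [TM2.stepAux]
    rw [ih hks.2]
    congr 2
    · have h1 : (∃ k ∈ ks, update S a (S a).tail k ≠ []) ↔ ∃ k ∈ ks, S k ≠ [] := by
        refine exists_congr fun k => and_congr_right fun hk => ?_
        rw [update_of_ne (ne_of_mem_of_not_mem hk hks.1)]
      simp only [h1, List.mem_cons, exists_eq_or_imp]
      cases S a <;> simp
    · funext k
      by_cases h : k = a
      · subst h
        simp [hks.1]
      · simp [h]

/-- Labels of the whole machine: `inr false` reads the input, `inr true` cleans up. -/
abbrev MLab (p : LoopProg K σ) := Lab p ⊕ Bool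

variable [Fintype K]

/-- The machine that reads its input into stack `inp`, starts the clocks, runs `p`, empties
all stacks, and returns the value of `out`. -/
noncomputable def machineCode (p : LoopProg K σ) [DecidableEq (Lab p)] (inp : K) (s₀ : σ)
    (out : σ → Bool) : MLab p → Code K σ (MLab p)
  | .inl l => code p Sum.inl (.inr true) l
  | .inr false => .pop .input (fun v o => (v.1, o))
      (branch (fun v => v.2.isSome)
        (.push (.data inp) (fun v => v.2.getD false)
          (pushTicks Finset.univ.toList
            (.load (fun v => (v.1, none)) (goto fun _ => .inr false))))
        (goto fun _ => .inl (entry p)))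
  | .inr true => popAll Finset.univ.toList
      (branch (fun v => v.2.isSome)
        (.load (fun v => (v.1, none)) (goto fun _ => .inr true))
        (.push .output (fun v => out v.1) (.load (fun _ => (s₀, none)) halt)))

/-- The step that copies a bit also pushes a tick onto every clock, so all clocks end up with as
many ticks as the input is long. The copy is reversed, and one more step notices the end of the
input. -/
theorem reachesIn_read (p : LoopProg K σ) [DecidableEq (Lab p)] (inp : K) (s₀ : σ)
    (out : σ → Bool) (w : List Bool) (d : K → List Bool) (n : ℕ) :
    ReachesIn (TM2.step (machineCode p inp s₀ out)) (w.length + 1)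
      ⟨some (.inr false), (s₀, none),
        update (contents d (fun _ => List.replicate n true) fun _ => []) .input w⟩
      (cfg (.inl (entry p)) (s₀, update d inp (w.reverse ++ d inp))
        (fun _ => List.replicate (n + w.length) true) fun _ => []) := by
  induction w generalizing d n with
  | nil =>
    refine .single ?_
    simp [TM2.step, machineCode, cfg, contents]
  | cons b w ih =>
    have := ih (update d inp (b :: d inp)) (n + 1)
    simp only [update_self, update_idem] at this
    rw [List.length_cons, add_comm, List.reverse_cons, List.append_assoc, List.singleton_append,
      show n + (w.length + 1) = n + 1 + w.length by omega]
    refine ReachesIn.trans (.single ?_) this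
    simp only [TM2.step, machineCode, TM2.stepAux, update_self, List.head?_cons,
      Option.isSome_some, cond_true, Option.getD_some, update_idem, List.tail_cons]
    rw [update_comm (by simp), update_contents_data, stepAux_pushTicks_univ]
    simp only [TM2.stepAux]
    rfl

/-- `haltList` demands that the machine halts with its initial internal state and with all stacks
empty except for the output. Each cleaning step pops every stack at once, so a bound on the heights
bounds the number of steps. -/
theorem reachesIn_clean (p : LoopProg K σ) [DecidableEq (Lab p)] (inp : K) (s₀ : σ)
    (out : σ → Bool) (n : ℕ) (v : σ) (S : Stk K (MLab p) → List Bool)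
    (hS : ∀ k, (S k).length ≤ n) :
    ReachesIn (TM2.step (machineCode p inp s₀ out)) (n + 1) ⟨some (.inr true), (v, none), S⟩
      ⟨none, (s₀, none), update (fun _ => []) .output [out v]⟩ := by
  induction n generalizing S with
  | zero =>
    have : S = fun _ => [] := by
      funext k
      simpa using hS k
    subst this
    refine .single ?_
    simp only [TM2.step, machineCode]
    rw [stepAux_popAll _ (Finset.nodup_toList _)]
    simp
  | succ n ih =>
    by_cases h : ∃ k, S k ≠ []
    · rw [add_comm]
      refine .trans (.single ?_) (ih (fun k => (S k).tail) (fun k => ?_))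
      · simp only [TM2.step, machineCode]
        rw [stepAux_popAll _ (Finset.nodup_toList _)]
        simp [h]
      · have := hS k
        simp
        omega
    · push Not at h
      refine .mono (ih S fun k => by simp [h k]) (by omega)

/-- The bundled machine that runs a program. -/
noncomputable def machine [Fintype σ] (p : LoopProg K σ) [DecidableEq (Lab p)] (inp : K) (s₀ : σ)
    (out : σ → Bool) : FinTM2 where
  K := Stk K (MLab p)
  k₀ := .input
  k₁ := .output
  Γ := fun _ => Bool
  Λ := MLab p
  main := .inr false
  σ := σ × Option Bool
  initialState := (s₀, none)
  Γk₀Fin := inferInstanceAs (Fintype Bool)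
  m := machineCode p inp s₀ out

theorem initList_machine [Fintype σ] (p : LoopProg K σ) [DecidableEq (Lab p)] (inp : K) (s₀ : σ)
    (out : σ → Bool) (w : List Bool) :
    initList (machine p inp s₀ out) w = (⟨some (.inr false), (s₀, none),
        update (contents (fun _ => []) (fun _ => List.replicate 0 true) fun _ => []) .input w⟩ :
      TM2.Cfg (fun _ : Stk K (MLab p) => Bool) (MLab p) (σ × Option Bool)) := by
  simp only [initList, machine]
  congr
  funext k
  cases k <;> simp [contents]
  rfl

theorem haltList_machine [Fintype σ] (p : LoopProg K σ) [DecidableEq (Lab p)] (inp : K) (s₀ : σ)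
    (out : σ → Bool) (w : List Bool) :
    haltList (machine p inp s₀ out) w = (⟨none, (s₀, none), update (fun _ => []) .output w⟩ :
      TM2.Cfg (fun _ : Stk K (MLab p) => Bool) (MLab p) (σ × Option Bool)) := by
  simp only [haltList, machine]
  congr
  funext k
  cases k <;> simp
  rfl

/-- A program of loops decides its problem in polynomial time. -/
theorem polyTime_of_run [Fintype σ] {α : Type} (enc : α → List Bool)
    (f : α → Bool) (p : LoopProg K σ) (inp : K) (s₀ : σ) (out : σ → Bool)
    (h : ∀ x, out (run (enc x).length p
      (s₀, update (fun _ => []) inp (enc x).reverse)).1 = f x) :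
    Nonempty (TM2ComputableInPolyTime enc Computability.encodeBool f) := by
  classical
  refine ⟨{
    tm := machine p inp s₀ out
    inputAlphabet := Equiv.refl Bool
    outputAlphabet := Equiv.refl Bool
    time := (Polynomial.X + 1) + (time p + (Polynomial.X + time p + 1))
    outputsFun := fun x => Nonempty.some ?_ }⟩
  set w := enc x with hw
  have r1 := reachesIn_read p inp s₀ out w (fun _ => []) 0
  have r2 := reachesIn_code (machineCode p inp s₀ out) w.length p Sum.inl Sum.inl_injective
    (.inr true) (fun l => rfl) (fun _ => List.replicate w.length true) (fun _ => [])
    (fun _ => rfl) (fun _ => rfl) (s₀, update (fun _ => []) inp w.reverse)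
  have r3 := reachesIn_clean p inp s₀ out (w.length + (time p).eval w.length)
    (run w.length p (s₀, update (fun _ => []) inp w.reverse)).1
    (contents (run w.length p (s₀, update (fun _ => []) inp w.reverse)).2
      (fun _ => List.replicate w.length true) fun _ => []) (fun k => by
      cases k with
      | data k =>
        refine (length_run_le _ _ _ _).trans ?_
        gcongr
        by_cases hk : k = inp
        · subst hk; simp
        · simp [update_of_ne hk]
      | _ => simp [contents])
  rw [List.append_nil, Nat.zero_add] at r1
  obtain ⟨m, hm, r⟩ := r1.trans (r2.trans r3)
  refine ⟨⟨⟨m, ?_⟩, ?_⟩⟩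
  · rw [h x] at r
    have e₀ : List.map (Equiv.refl Bool).invFun w = w := List.map_id w
    have e₁ := (congrArg (initList (machine p inp s₀ out)) e₀).trans
      (initList_machine p inp s₀ out w)
    rw [← e₁, ← haltList_machine p inp s₀ out] at r
    exact r
  · simpa using hm

end machine

end LoopProg

/-! ### Subroutines that move elements between stacks. -/

open Turing Function

namespace LoopProg

variable {K σ : Type} [DecidableEq K] {L : ℕ}

/-- Move the top element of stack `a`, if there is one, to stack `b`. -/
def moveTop (a b : K) (S : K → List Bool) : K → List Bool :=
  match S a with
  | [] => S
  | x :: l => update (update S a l) b (x :: S b)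

/-- Moves from an exhausted stack do nothing, which agrees with `take` and `drop` beyond the length
of a list. -/
theorem moveTop_iterate {a b : K} (hab : a ≠ b) (n : ℕ) (S : K → List Bool) :
    (moveTop a b)^[n] S =
      update (update S a ((S a).drop n)) b (((S a).take n).reverse ++ S b) := by
  induction n generalizing S with
  | zero => simp
  | succ n ih =>
    rw [iterate_succ_apply, ih]
    cases h : S a with
    | nil =>
      have : moveTop a b S = S := by simp [moveTop, h]
      simp [this, h]
    | cons x l =>
      have : moveTop a b S = update (update S a l) b (x :: S b) := by simp [moveTop, h]
      rw [this]
      funext k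
      by_cases hb : k = b
      · subst hb
        simp [update_of_ne hab]
      · by_cases ha : k = a
        · subst ha
          simp [hb]
        · simp [ha, hb]

theorem moveTop_iterate_apply_of_ne {a b k : K} (ha : k ≠ a) (hb : k ≠ b) (n : ℕ)
    (S : K → List Bool) : (moveTop a b)^[n] S k = S k := by
  induction n with
  | zero => rfl
  | succ n ih =>
    rw [iterate_succ_apply', ← ih]
    generalize (moveTop a b)^[n] S = S'
    cases h : S' a <;> simp [moveTop, h, ha, hb]

theorem moveTop_update {a b k : K} (ha : k ≠ a) (hb : k ≠ b) (S : K → List Bool)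
    (l : List Bool) : moveTop a b (update S k l) = update (moveTop a b S) k l := by
  unfold moveTop
  rw [update_of_ne ha.symm, update_of_ne hb.symm]
  split
  · rfl
  · rw [update_comm ha, update_comm hb]

theorem moveTop_iterate_update {a b k : K} (ha : k ≠ a) (hb : k ≠ b) (n : ℕ)
    (S : K → List Bool) (l : List Bool) :
    (moveTop a b)^[n] (update S k l) = update ((moveTop a b)^[n] S) k l := by
  induction n with
  | zero => rfl
  | succ n ih => rw [iterate_succ_apply', iterate_succ_apply', ih, moveTop_update ha hb]

/-- This is how random access is undone: `n` elements are parked on the empty stack `b`, the rest of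
`a` may be changed to `m`, and the same number of moves brings the parked elements back. -/
theorem moveTop_back {a b : K} (hab : a ≠ b) {n : ℕ} {S : K → List Bool} (hb : S b = [])
    (hn : n ≤ (S a).length) (m : List Bool) :
    (moveTop b a)^[n] (update ((moveTop a b)^[n] S) a m) =
      update S a ((S a).take n ++ m) := by
  rw [moveTop_iterate hab.symm, moveTop_iterate hab]
  funext k
  by_cases h1 : k = a
  · subst h1
    simp [update_of_ne hab.symm, hn]
  · by_cases h2 : k = b
    · subst h2
      simp [h1, hb, List.drop_eq_nil_of_le]
    · simp [h1, h2]

/-- Programs with an auxiliary register that holds an element of a stack. -/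
abbrev AuxProg (K σ : Type) := LoopProg K (σ × Option Bool)

theorem run_seq (p q : LoopProg K σ) (s : σ × (K → List Bool)) :
    run L (seq p q) s = run L q (run L p s) :=
  rfl

theorem run_loop (p : LoopProg K σ) (s : σ × (K → List Bool)) :
    run L (loop p) s = (run L p)^[L] s :=
  rfl

def skip : AuxProg K σ := load id

/-- Pop an element into the auxiliary register; if there was one, execute `p`. -/
def popThen (a : K) (p : AuxProg K σ) : AuxProg K σ :=
  seq (pop a fun v o => (v.1, o)) (ite (fun v => v.2.isSome) p skip)

/-- Push the auxiliary register. -/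
def pushReg (b : K) : AuxProg K σ :=
  seq (push b fun v => v.2.getD false) (load fun v => (v.1, none))

def move (a b : K) : AuxProg K σ :=
  popThen a (pushReg b)

theorem run_move {a b : K} (hab : a ≠ b) (c : σ) (S : K → List Bool) :
    run L (move a b) ((c, none), S) = ((c, none), moveTop a b S) := by
  cases h : S a with
  | nil =>
    have : update S a [] = S := by rw [← h, update_eq_self]
    simp [move, popThen, skip, run, moveTop, h, this]
  | cons x l => simp [move, popThen, pushReg, run, moveTop, h, update_of_ne hab.symm]

theorem iterate_pair {X Y : Type} {f : X × Y → X × Y} {g : Y → Y} {c : X}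
    (h : ∀ S, f (c, S) = (c, g S)) (n : ℕ) (S : Y) : f^[n] (c, S) = (c, g^[n] S) := by
  induction n generalizing S with
  | zero => rfl
  | succ n ih => rw [iterate_succ_apply, h, ih, iterate_succ_apply]

theorem run_loop_moves {p : AuxProg K σ} {a b : K} {c : σ} {n : ℕ}
    (hp : ∀ S, run L p ((c, none), S) = ((c, none), (moveTop a b)^[n] S)) (S : K → List Bool) :
    run L (loop p) ((c, none), S) = ((c, none), (moveTop a b)^[n * L] S) := by
  rw [run, iterate_pair hp, ← iterate_mul]

/-- Execute `p` once for every element of the stack `d`, with the help of the empty stack `e`. -/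
def forTicks (d e : K) (p : AuxProg K σ) : AuxProg K σ :=
  seq (loop (popThen d (seq (pushReg e) p))) (loop (move e d))

/-- The ticks on `d` are consumed one by one and collected on `e`, from where they are returned at
the end. Since `p` touches neither of these stacks, its moves commute with this bookkeeping and add
up to `n * x`. -/
theorem run_forTicks {p : AuxProg K σ} {a b d e : K} {c : σ} {n : ℕ} (hde : d ≠ e)
    (hda : d ≠ a) (hdb : d ≠ b) (hea : e ≠ a) (heb : e ≠ b)
    (hp : ∀ S, run L p ((c, none), S) = ((c, none), (moveTop a b)^[n] S)) (S : K → List Bool)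
    (x : ℕ) (hx : x ≤ L) (hd : S d = List.replicate x true) (he : S e = []) :
    run L (forTicks d e p) ((c, none), S) = ((c, none), (moveTop a b)^[n * x] S) := by
  let st : ℕ → K → List Bool := fun i => (moveTop a b)^[n * i]
    (update (update S d (List.replicate (x - i) true)) e (List.replicate i true))
  have hst0 : st 0 = S := by
    simp only [st, Nat.sub_zero, Nat.mul_zero, iterate_zero_apply, List.replicate_zero]
    rw [← hd, update_eq_self, ← he, update_eq_self]
  have step : ∀ i < x, run L (popThen d (seq (pushReg e) p)) ((c, none), st i) =
      ((c, none), st (i + 1)) := by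
    intro i hi
    obtain ⟨j, hj⟩ : ∃ j, x - i = j + 1 := ⟨x - i - 1, by omega⟩
    have hj' : x - (i + 1) = j := by omega
    have h1 : st i d = true :: List.replicate j true := by
      simp only [st]
      rw [moveTop_iterate_apply_of_ne hda hdb, update_of_ne hde, update_self, hj,
        List.replicate_succ]
    have h2 : st i e = List.replicate i true := by
      simp only [st]
      rw [moveTop_iterate_apply_of_ne hea heb, update_self]
    simp only [popThen, pushReg, run, h1, List.head?_cons, Option.isSome_some, cond_true,
      Option.getD_some, List.tail_cons, update_of_ne hde.symm, h2, hp]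
    congr 1
    simp only [st]
    rw [← moveTop_iterate_update hda hdb, ← moveTop_iterate_update hea heb,
      ← iterate_add_apply, update_comm hde, update_idem, update_comm hde.symm, update_idem, hj',
      update_comm hde, ← List.replicate_succ, Nat.mul_succ, Nat.add_comm, update_comm hde]
  have finished : run L (popThen d (seq (pushReg e) p)) ((c, none), st x) = ((c, none), st x) := by
    have h1 : st x d = [] := by
      simp only [st]
      rw [moveTop_iterate_apply_of_ne hda hdb, update_of_ne hde, update_self]
      simp
    simp only [popThen, run, h1, List.head?_nil, Option.isSome_none, cond_false, skip, id,
      List.tail_nil]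
    rw [← h1, update_eq_self]
  have iter : ∀ i ≤ x, (run L (popThen d (seq (pushReg e) p)))^[i] ((c, none), S) =
      ((c, none), st i) := by
    intro i hi
    induction i with
    | zero => rw [iterate_zero_apply, hst0]
    | succ i ih => rw [iterate_succ_apply', ih (by omega), step i (by omega)]
  -- The loop always makes `L` rounds: the first `x` do the work, and the others find `d` empty and
  -- change nothing.
  have hL : L = (L - x) + x := by omega
  simp only [forTicks, run]
  have hall : (run L (popThen d (seq (pushReg e) p)))^[L] ((c, none), S) = ((c, none), st x) := by
    rw [congrArg (fun n => (run L (popThen d (seq (pushReg e) p)))^[n] ((c, none), S)) hL,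
      iterate_add_apply, iter x le_rfl, iterate_fixed finished]
  rw [hall]
  rw [iterate_pair (fun S => run_move hde.symm c S), moveTop_iterate hde.symm]
  congr 1
  simp only [st]
  rw [moveTop_iterate_apply_of_ne hda hdb, moveTop_iterate_apply_of_ne hea heb, update_self,
    update_of_ne hde, update_self, ← moveTop_iterate_update hea heb,
    ← moveTop_iterate_update hda hdb, update_idem]
  congr 1
  funext k
  by_cases h1 : k = d
  · subst h1
    simp [hd, hx]
  · by_cases h2 : k = e
    · subst h2
      simp [h1, he, hx]
    · simp [h1, h2]

end LoopProg

/-! ### Table programs and their translation to loop programs. -/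

/-- Programs that work on finitely many variables with values in `Fin L`, finitely many tables of
bits that are indexed by triples of such values, and a finite control state. The body of a `loop`
is executed `L` times, where `L` is the length of the input. -/
inductive TableProg (T V σ : Type)
  | assign (f : σ → σ)
  | read (t : T) (x y z : V) (f : σ → Bool → σ)
  | write (t : T) (x y z : V) (b : Bool)
  | incr (x : V)
  | reset (x : V)
  | seq (p q : TableProg T V σ)
  | ite (c : σ → Bool) (p q : TableProg T V σ)
  | loop (p : TableProg T V σ)

/-- The states of table programs for inputs of length `L`. -/
structure TableState (T V σ : Type) (L : ℕ) where
  reg : σ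
  var : V → Fin L
  tab : T → Set (Fin L × Fin L × Fin L)

namespace TableProg

variable {T V σ : Type} [DecidableEq T] [DecidableEq V] {L : ℕ} [NeZero L]

/-- The truth value of a proposition. -/
noncomputable def bit (P : Prop) : Bool :=
  @decide P (Classical.propDecidable P)

@[simp]
theorem bit_eq_true {P : Prop} : bit P = true ↔ P := by
  simp [bit]

/-- The semantics of table programs. Incrementing a variable wraps around. -/
noncomputable def run : TableProg T V σ → TableState T V σ L → TableState T V σ L
  | assign f => fun s => { s with reg := f s.reg }
  | read t x y z f => fun s =>
    { s with reg := f s.reg (bit ((s.var x, s.var y, s.var z) ∈ s.tab t)) }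
  | write t x y z b => fun s => { s with
      tab := update s.tab t (bif b then insert (s.var x, s.var y, s.var z) (s.tab t)
        else s.tab t \ {(s.var x, s.var y, s.var z)}) }
  | incr x => fun s => { s with var := update s.var x (s.var x + 1) }
  | reset x => fun s => { s with var := update s.var x 0 }
  | seq p q => fun s => run q (run p s)
  | ite c p q => fun s => bif c s.reg then run p s else run q s
  | loop p => (run p)^[L]

/-- The stacks that represent the state of a table program. -/
inductive Stack (T V : Type)
  | input
  | main (t : T)
  | aux (t : T)
  | done (v : V)
  | todo (v : V)
  | tmp (v : V)
  deriving DecidableEq, Fintype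

/-- The position of a triple in the list that represents a table. -/
def pos (L : ℕ) : Fin L × Fin L × Fin L ≃ Fin (L * (L * L)) :=
  (Equiv.prodCongrRight fun _ => finProdFinEquiv).trans finProdFinEquiv

-- The summands have the form in which `run_loop_moves` and `run_forTicks` count the moves of
-- `seek`: two, one or no nested loops, repeated for each tick of a variable.
omit [NeZero L] in
theorem pos_val (x y z : Fin L) : (pos L (x, y, z) : ℕ) = 1 * L * L * x + 1 * L * y + 1 * z := by
  simp [pos, finProdFinEquiv]
  ring

open Classical in
/-- The contents of the stack that represents a table. -/
noncomputable def tableList (S : Set (Fin L × Fin L × Fin L)) : List Bool :=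
  List.ofFn fun k => decide ((pos L).symm k ∈ S)

/-- The contents of the stacks that represent variables and tables. -/
noncomputable def stackOf (s : TableState T V σ L) : Stack T V → List Bool
  | .input => []
  | .main t => tableList (s.tab t)
  | .aux _ => []
  | .done v => List.replicate (s.var v) true
  | .todo v => List.replicate (L - s.var v) true
  | .tmp _ => []

/-- The state of a loop program that represents a state of a table program. -/
noncomputable def repr (s : TableState T V σ L) : (σ × Option Bool) × (Stack T V → List Bool) :=
  ((s.reg, none), stackOf s)

open LoopProg in
/-- Move elements from stack `a` to stack `b`, as many as the position of `(x, y, z)` says. -/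
def seek (a b : Stack T V) (x y z : V) : AuxProg (Stack T V) σ :=
  .seq (forTicks (.done x) (.tmp x) (.loop (.loop (move a b))))
    (.seq (forTicks (.done y) (.tmp y) (.loop (move a b)))
      (forTicks (.done z) (.tmp z) (move a b)))

omit [NeZero L] in
theorem run_seek {a b : Stack T V} (hab : a ≠ b) (hda : ∀ v, .done v ≠ a)
    (hdb : ∀ v, .done v ≠ b) (hea : ∀ v, .tmp v ≠ a) (heb : ∀ v, .tmp v ≠ b)
    (x y z : V) (s : TableState T V σ L) (c : σ) (S : Stack T V → List Bool)
    (hd : ∀ v, S (.done v) = List.replicate (s.var v) true) (he : ∀ v, S (.tmp v) = []) :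
    LoopProg.run L (seek a b x y z) ((c, none), S) =
      ((c, none), (LoopProg.moveTop a b)^[pos L (s.var x, s.var y, s.var z)] S) := by
  have h0 : ∀ S, LoopProg.run L (LoopProg.move a b) ((c, none), S) =
    ((c, none), (LoopProg.moveTop a b)^[1] S) := fun S => LoopProg.run_move hab c S
  have h1 := LoopProg.run_loop_moves h0
  have h2 := LoopProg.run_loop_moves h1
  simp only [seek, LoopProg.run]
  rw [LoopProg.run_forTicks (by simp) (hda _) (hdb _) (hea _) (heb _) h2 S (s.var x)
    (s.var x).isLt.le (hd x) (he x)]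
  rw [LoopProg.run_forTicks (by simp) (hda _) (hdb _) (hea _) (heb _) h1 _ (s.var y)
    (s.var y).isLt.le
    (by rw [LoopProg.moveTop_iterate_apply_of_ne (hda _) (hdb _)]; exact hd y)
    (by rw [LoopProg.moveTop_iterate_apply_of_ne (hea _) (heb _)]; exact he y)]
  rw [LoopProg.run_forTicks (by simp) (hda _) (hdb _) (hea _) (heb _) h0 _ (s.var z)
    (s.var z).isLt.le
    (by rw [← iterate_add_apply, LoopProg.moveTop_iterate_apply_of_ne (hda _) (hdb _)]
        exact hd z)
    (by rw [← iterate_add_apply, LoopProg.moveTop_iterate_apply_of_ne (hea _) (heb _)]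
        exact he z)]
  rw [← iterate_add_apply, ← iterate_add_apply, pos_val]
  congr 2
  ring

open LoopProg in
/-- The translation of table programs to loop programs. -/
def compile : TableProg T V σ → AuxProg (Stack T V) σ
  | assign f => .load fun v => (f v.1, v.2)
  | read t x y z f => .seq (seek (.main t) (.aux t) x y z)
      (.seq (.peek (.main t) fun v o => (f v.1 (o.getD false), v.2))
        (seek (.aux t) (.main t) x y z))
  | write t x y z b => .seq (seek (.main t) (.aux t) x y z)
      (.seq (.pop (.main t) fun v _ => v) (.seq (.push (.main t) fun _ => b)
        (seek (.aux t) (.main t) x y z)))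
  | incr x => .seq (move (.todo x) (.done x))
      (.seq (.peek (.todo x) fun v o => (v.1, o))
        (.ite (fun v => v.2.isSome) (.load fun v => (v.1, none))
          (.loop (move (.done x) (.todo x)))))
  | reset x => .loop (move (.done x) (.todo x))
  | seq p q => .seq (compile p) (compile q)
  | ite c p q => .ite (fun v => c v.1) (compile p) (compile q)
  | loop p => .loop (compile p)

omit [NeZero L] in
theorem length_tableList (S : Set (Fin L × Fin L × Fin L)) :
    (tableList S).length = L * (L * L) := by
  simp [tableList]

omit [NeZero L] in
open Classical in
theorem getElem?_tableList (S : Set (Fin L × Fin L × Fin L)) (i : Fin L × Fin L × Fin L) :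
    (tableList S)[(pos L i : ℕ)]? = some (decide (i ∈ S)) := by
  rw [List.getElem?_eq_getElem (by rw [length_tableList]; exact (pos L i).isLt)]
  simp [tableList]

omit [NeZero L] in
theorem set_tableList (S : Set (Fin L × Fin L × Fin L)) (i : Fin L × Fin L × Fin L) (b : Bool) :
    (tableList S).set (pos L i) b = tableList (bif b then insert i S else S \ {i}) := by
  apply List.ext_getElem
  · simp [length_tableList]
  · intro n h1 h2
    simp only [List.getElem_set, tableList, List.getElem_ofFn]
    have hn : n < L * (L * L) := by rwa [length_tableList] at h2
    by_cases h : (pos L i : ℕ) = n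
    · subst h
      cases b <;> simp
    · have h' : (pos L).symm ⟨n, hn⟩ ≠ i := by
        rintro rfl
        simp at h
      rw [if_neg h]
      cases b <;> simp [h']

theorem run_compile_read (t : T) (x y z : V) (f : σ → Bool → σ) (s : TableState T V σ L) :
    LoopProg.run L (compile (read t x y z f)) (repr s) = repr (run (read t x y z f) s) := by
  have hlen : (pos L (s.var x, s.var y, s.var z) : ℕ) ≤ (stackOf s (.main t)).length := by
    simp only [stackOf, length_tableList]
    exact (pos L _).isLt.le
  simp only [compile, LoopProg.run, repr, run]
  rw [run_seek (by simp) (by simp) (by simp) (by simp) (by simp) x y z s s.reg _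
    (fun _ => rfl) (fun _ => rfl)]
  dsimp only
  rw [run_seek (by simp) (by simp) (by simp) (by simp) (by simp) x y z s _ _
    (fun v => by rw [LoopProg.moveTop_iterate_apply_of_ne (by simp) (by simp)]; rfl)
    (fun v => by rw [LoopProg.moveTop_iterate_apply_of_ne (by simp) (by simp)]; rfl)]
  have back := LoopProg.moveTop_back (a := .main t) (b := .aux t) (by simp)
    (S := stackOf s) rfl hlen ((stackOf s (.main t)).drop (pos L (s.var x, s.var y, s.var z)))
  have top : (LoopProg.moveTop (Stack.main t) (.aux t))^[pos L (s.var x, s.var y, s.var z)]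
      (stackOf s) (.main t) =
      (stackOf s (.main t)).drop (pos L (s.var x, s.var y, s.var z)) := by
    rw [LoopProg.moveTop_iterate (by simp), update_of_ne (by simp), update_self]
  rw [List.take_append_drop, update_eq_self, ← top, update_eq_self] at back
  rw [back, top, List.head?_drop]
  simp only [stackOf, getElem?_tableList, Option.getD_some]
  rfl

theorem run_compile_write (t : T) (x y z : V) (b : Bool) (s : TableState T V σ L) :
    LoopProg.run L (compile (write t x y z b)) (repr s) = repr (run (write t x y z b) s) := by
  have hlen : (pos L (s.var x, s.var y, s.var z) : ℕ) ≤ (stackOf s (.main t)).length := by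
    simp only [stackOf, length_tableList]
    exact (pos L _).isLt.le
  simp only [compile, LoopProg.run, repr, run]
  rw [run_seek (by simp) (by simp) (by simp) (by simp) (by simp) x y z s s.reg _
    (fun _ => rfl) (fun _ => rfl)]
  dsimp only
  rw [run_seek (by simp) (by simp) (by simp) (by simp) (by simp) x y z s _ _
    (fun v => by
      rw [update_of_ne (by simp), update_of_ne (by simp),
        LoopProg.moveTop_iterate_apply_of_ne (by simp) (by simp)]
      rfl)
    (fun v => by
      rw [update_of_ne (by simp), update_of_ne (by simp),
        LoopProg.moveTop_iterate_apply_of_ne (by simp) (by simp)]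
      rfl)]
  have top : (LoopProg.moveTop (Stack.main t) (.aux t))^[pos L (s.var x, s.var y, s.var z)]
      (stackOf s) (.main t) =
      (stackOf s (.main t)).drop (pos L (s.var x, s.var y, s.var z)) := by
    rw [LoopProg.moveTop_iterate (by simp), update_of_ne (by simp), update_self]
  rw [update_idem, update_self, top, LoopProg.moveTop_back (by simp) rfl hlen, List.tail_drop]
  congr 1
  funext k
  cases k with
  | main t' =>
    by_cases h : t' = t
    · subst h
      simp only [update_self, stackOf]
      rw [← set_tableList, List.set_eq_take_append_cons_drop, if_pos]
      rw [length_tableList]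
      exact (pos L _).isLt
    · simp [stackOf, h]
  | _ => simp [stackOf]

theorem run_compile_reset (x : V) (s : TableState T V σ L) :
    LoopProg.run L (compile (reset x)) (repr s) = repr (run (reset x) s) := by
  simp only [compile, LoopProg.run, repr, run]
  rw [LoopProg.iterate_pair (fun S => LoopProg.run_move (by simp) s.reg S),
    LoopProg.moveTop_iterate (by simp)]
  congr 1
  have hx := (s.var x).isLt
  funext k
  cases k with
  | done v =>
    by_cases h : v = x
    · subst h
      simp [stackOf, hx.le]
    · simp [stackOf, h]
  | todo v =>
    by_cases h : v = x
    · subst h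
      simp [stackOf, hx.le]
    · simp [stackOf, h]
  | _ => simp [stackOf]

theorem run_compile_incr (x : V) (s : TableState T V σ L) :
    LoopProg.run L (compile (incr x)) (repr s) = repr (run (incr x) s) := by
  have hx := (s.var x).isLt
  simp only [compile, LoopProg.run, repr, run]
  rw [LoopProg.run_move (by simp)]
  have hm := LoopProg.moveTop_iterate (a := Stack.todo x) (b := .done x) (by simp) 1
    (stackOf s : Stack T V → List Bool)
  rw [iterate_one] at hm
  rw [hm]
  obtain ⟨j, hj⟩ : ∃ j, L - s.var x = j + 1 := ⟨L - s.var x - 1, by omega⟩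
  have hinc : ((s.var x + 1 : Fin L) : ℕ) = (s.var x + 1) % L := by
    rw [Fin.val_add, Fin.val_one', Nat.add_mod_mod]
  simp only [stackOf, hj, List.replicate_succ, List.take_succ_cons, List.take_zero,
    List.drop_succ_cons, List.drop_zero, List.reverse_singleton, List.singleton_append]
  rw [update_of_ne (by simp), update_self]
  cases j with
  | zero =>
    have hlast : (s.var x + 1 : Fin L) = 0 := by
      apply Fin.ext
      rw [hinc, show (s.var x : ℕ) + 1 = L by omega]
      simp
    simp only [List.replicate_zero, List.head?_nil, Option.isSome_none, cond_false]
    rw [LoopProg.iterate_pair (fun S => LoopProg.run_move (by simp) s.reg S),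
      LoopProg.moveTop_iterate (by simp)]
    congr 1
    funext k
    cases k with
    | done v =>
      by_cases h : v = x
      · subst h
        simp [stackOf, hlast]
      · simp [stackOf, h]
    | todo v =>
      by_cases h : v = x
      · subst h
        simp only [update_self, ne_eq, reduceCtorEq, not_false_eq_true, update_of_ne, stackOf, hlast]
        rw [← List.replicate_succ, List.take_replicate, List.reverse_replicate,
          show min L ((s.var v : ℕ) + 1) = L by omega]
        simp
      · simp [stackOf, h]
    | _ => simp [stackOf]
  | succ j =>
    have hval : ((s.var x + 1 : Fin L) : ℕ) = s.var x + 1 := by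
      rw [hinc, Nat.mod_eq_of_lt (by omega)]
    simp only [List.replicate_succ, List.head?_cons, Option.isSome_some, cond_true]
    congr 1
    funext k
    cases k with
    | done v =>
      by_cases h : v = x
      · subst h
        simp [stackOf, hval, List.replicate_succ]
      · simp [stackOf, h]
    | todo v =>
      by_cases h : v = x
      · subst h
        simp [stackOf, hval, ← List.replicate_succ, show L - ((s.var v : ℕ) + 1) = j + 1 by omega]
      · simp [stackOf, h]
    | _ => simp [stackOf]

theorem run_compile (p : TableProg T V σ) (s : TableState T V σ L) :
    LoopProg.run L (compile p) (repr s) = repr (run p s) := by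
  induction p generalizing s with
  | assign f => rfl
  | read t x y z f => exact run_compile_read t x y z f s
  | write t x y z b => exact run_compile_write t x y z b s
  | incr x => exact run_compile_incr x s
  | reset x => exact run_compile_reset x s
  | seq p q hp hq =>
    simp only [compile, LoopProg.run, run, hp, hq]
  | ite c p q hp hq =>
    simp only [compile, LoopProg.run, run]
    rw [show (repr s).1.1 = s.reg from rfl]
    cases c s.reg <;> simp only [cond_true, cond_false, hp, hq]
  | loop p hp =>
    simp only [compile, LoopProg.run, run]
    exact (Semiconj.iterate_right (f := repr) (fun s => (hp s).symm) L s).symm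

/-! ### Initialization of tables and variables. -/

section setup

open LoopProg

/-- Execute the programs `q k` for all `k` in a list. -/
def forStacks {K : Type} (ks : List K) (q : K → AuxProg K σ) : AuxProg K σ :=
  ks.foldr (fun k p => .seq (q k) p) skip

theorem run_push_iterate {K : Type} [DecidableEq K] (k : K) (b : Bool) (n L : ℕ)
    (c : σ × Option Bool) (S : K → List Bool) :
    (LoopProg.run L (.push k fun _ => b))^[n] (c, S) =
      (c, update S k (List.replicate n b ++ S k)) := by
  induction n generalizing S with
  | zero => simp
  | succ n ih =>
    rw [iterate_succ_apply', ih]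
    simp [LoopProg.run, List.replicate_succ]

theorem run_forStacks {K : Type} [DecidableEq K] (ks : List K) (hks : ks.Nodup)
    (q : K → AuxProg K σ) (l : List Bool) (L : ℕ) (c : σ × Option Bool)
    (hq : ∀ k S, LoopProg.run L (q k) (c, S) = (c, update S k (l ++ S k)))
    (S : K → List Bool) :
    LoopProg.run L (forStacks ks q) (c, S) = (c, fun k => if k ∈ ks then l ++ S k else S k) := by
  induction ks generalizing S with
  | nil => simp [forStacks, skip, LoopProg.run]
  | cons a ks ih =>
    rw [List.nodup_cons] at hks
    rw [show forStacks (a :: ks) q = .seq (q a) (forStacks ks q) from rfl]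
    simp only [LoopProg.run, hq, ih hks.2]
    congr 1
    funext k
    by_cases h : k = a
    · subst h
      simp [hks.1]
    · simp [h]

variable [Fintype T] [Fintype V]

/-- Fill the tables with zeros, set all variables to zero, and copy the input to the first
entries of table `inp`. -/
noncomputable def setup (inp : T) : AuxProg (Stack T V) σ :=
  .seq (forStacks (Finset.univ.toList.map .main) fun k => .loop (.loop (.loop (.push k fun _ => false))))
    (.seq (forStacks (Finset.univ.toList.map .todo) fun k => .loop (.push k fun _ => true))
      -- The first `L` zeros of table `inp` make room for the input. The input stack holds the word
      -- in reverse, so moving it over restores the order.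
      (.seq (.loop (.pop (.main inp) fun v _ => v))
        (.loop (move .input (.main inp)))))

/-- The state in which a table program starts on input `w`. -/
def start (inp : T) (r : σ) (w : List Bool) [NeZero w.length] : TableState T V σ w.length where
  reg := r
  var := fun _ => 0
  tab := update (fun _ => ∅) inp {i | i.1 = 0 ∧ i.2.1 = 0 ∧ w.get i.2.2 = true}

theorem iterate_pop {K : Type} [DecidableEq K] (k : K) (n L : ℕ) (c : σ × Option Bool)
    (S : K → List Bool) :
    (LoopProg.run L (.pop k fun v _ => v))^[n] (c, S) = (c, update S k ((S k).drop n)) := by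
  induction n generalizing S with
  | zero => simp
  | succ n ih =>
    rw [iterate_succ_apply', ih]
    simp [LoopProg.run]

/-- The triple `(0, 0, z)` has position `z`, so these triples occupy exactly the first `L` places of
the list. -/
theorem tableList_start (w : List Bool) [NeZero w.length] :
    tableList {i : Fin w.length × Fin w.length × Fin w.length |
      i.1 = 0 ∧ i.2.1 = 0 ∧ w.get i.2.2 = true} =
      w ++ (List.replicate (w.length * (w.length * w.length)) false).drop w.length := by
  have hL : 0 < w.length := NeZero.pos _
  apply List.ext_getElem
  · rw [length_tableList, List.length_append, List.length_drop, List.length_replicate]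
    have := Nat.le_mul_of_pos_right w.length (Nat.mul_pos hL hL)
    omega
  · intro n h1 h2
    rw [length_tableList] at h1
    obtain ⟨⟨x, y, z⟩, hi⟩ : ∃ i, pos w.length i = ⟨n, h1⟩ := (pos w.length).surjective _
    have hn : n = w.length * w.length * x + w.length * y + z := by
      have := pos_val x y z
      rw [hi] at this
      simpa using this
    have hsymm : (pos w.length).symm ⟨n, h1⟩ = (x, y, z) := by
      rw [← hi, Equiv.symm_apply_apply]
    simp only [tableList, List.getElem_ofFn, hsymm, Set.mem_ofPred_eq]
    by_cases h : n < w.length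
    · have hx : x = 0 := by
        apply Fin.ext
        by_contra hne
        have : 1 ≤ (x : ℕ) := Nat.one_le_iff_ne_zero.2 hne
        nlinarith
      have hy : y = 0 := by
        apply Fin.ext
        by_contra hne
        have : 1 ≤ (y : ℕ) := Nat.one_le_iff_ne_zero.2 hne
        nlinarith
      subst hx hy
      rw [List.getElem_append_left h]
      simp at hn
      subst hn
      simp
    · rw [List.getElem_append_right (by omega)]
      have : ¬ (x = 0 ∧ y = 0 ∧ w.get z = true) := by
        rintro ⟨rfl, rfl, -⟩
        simp at hn
        omega
      rw [decide_eq_false this]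
      simp

theorem run_setup (inp : T) (r : σ) (w : List Bool) [NeZero w.length] :
    LoopProg.run w.length (setup inp) ((r, none), update (fun _ : Stack T V => []) .input w.reverse) =
      repr (start inp r w) := by
  set c : σ × Option Bool := (r, none) with hc
  have h3 : ∀ (k : Stack T V) S, LoopProg.run w.length (.loop (.loop (.loop (.push k fun _ => false)))) (c, S) =
      (c, update S k (List.replicate (w.length * (w.length * w.length)) false ++ S k)) := by
    intro k S
    simp only [LoopProg.run]
    rw [← iterate_mul, ← iterate_mul, ← mul_assoc]
    exact run_push_iterate _ _ _ w.length _ _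
  have h1 : ∀ (k : Stack T V) S, LoopProg.run w.length (.loop (.push k fun _ => true)) (c, S) =
      (c, update S k (List.replicate w.length true ++ S k)) :=
    fun k S => run_push_iterate _ _ _ w.length _ _
  simp only [setup, run_seq]
  rw [run_forStacks _ ((Finset.nodup_toList _).map fun _ _ h => by simpa using h) _ _ _ _ h3]
  rw [run_forStacks _ ((Finset.nodup_toList _).map fun _ _ h => by simpa using h) _ _ _ _ h1]
  rw [run_loop, run_loop, iterate_pop, iterate_pair (fun S => run_move (by simp) r S), moveTop_iterate (by simp)]
  rw [repr]
  congr 1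
  funext k
  cases k with
  | main t =>
    by_cases h : t = inp
    · subst h
      have := tableList_start w
      simp only [List.get_eq_getElem, List.drop_replicate] at this

      simp [stackOf, start, this, List.take_of_length_le]
    · simp [stackOf, start, h, tableList, List.ofFn_const]
  | todo v => simp [stackOf, start]
  | _ => simp [stackOf, start]

/-- A table program decides its problem in polynomial time. -/
theorem polyTime_of_run [Fintype σ] {α : Type} (enc : α → List Bool)
    [∀ x, NeZero (enc x).length] (f : α → Bool) (p : TableProg T V σ) (inp : T) (r : σ)
    (out : σ → Bool) (h : ∀ x, out (run p (start inp r (enc x))).reg = f x) :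
    Nonempty (TM2ComputableInPolyTime enc Computability.encodeBool f) := by
  refine LoopProg.polyTime_of_run enc f (.seq (setup inp) (compile p)) .input (r, none)
    (fun v => out v.1) fun x => ?_
  simp only [LoopProg.run]
  rw [run_setup, run_compile, ← h x]
  rfl

end setup

end TableProg

/-! ### Fair computations give sustainable sets of transitions. -/

open Filter Relation Function

namespace BroadcastNet

namespace Network

variable {D Q : Type} (N : Network D Q)

/-- The states that occur in initialized computations of `N`. -/
inductive Reachable : Q → Prop
  | init {q : Q} : q ∈ N.init → Reachable q
  | send {p q : Q} {a : D} : Reachable p → (p, Op.send a, q) ∈ N.trans → Reachable q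
  | recv {p q p' q' : Q} {a : D} : Reachable p → (p, Op.recv a, q) ∈ N.trans → Reachable p' →
      (p', Op.send a, q') ∈ N.trans → Reachable q

/-- `T` has a transition from `p` to `q`. -/
def Edge (T : Set (Q × Op D × Q)) (p q : Q) : Prop :=
  ∃ o, (p, o, q) ∈ T

/-- A set of transitions between reachable states that contains a send for each of its receives
and a closed walk through `F` for each of its transitions. -/
structure Sustainable (F : Set Q) (T : Set (Q × Op D × Q)) : Prop where
  subset : T ⊆ N.trans
  reachable : ∀ {p o q}, (p, o, q) ∈ T → N.Reachable p
  exists_send : ∀ {p a q}, (p, Op.recv a, q) ∈ T → ∃ p' q', (p', Op.send a, q') ∈ T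
  cycle : ∀ {p o q}, (p, o, q) ∈ T →
    ∃ f ∈ F, ReflTransGen (Edge T) q f ∧ ReflTransGen (Edge T) f p

variable {N}

/-- The infinite pigeonhole principle. -/
theorem exists_frequently_eq {α : Type*} [Finite α] (f : ℕ → α) {P : ℕ → Prop}
    (h : ∃ᶠ t in atTop, P t) : ∃ a, ∃ᶠ t in atTop, P t ∧ f t = a := by
  by_contra! hc
  refine h ?_
  filter_upwards [eventually_all.2 hc] with t ht hP
  exact ht (f t) hP rfl

instance [Finite D] : Finite (Op D) :=
  Finite.of_injective (β := D ⊕ D)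
    (fun o => match o with
      | .send a => .inl a
      | .recv a => .inr a)
    (by rintro (a | a) (b | b) h <;> simp_all)

namespace InfComputation

variable {k : ℕ} (π : N.InfComputation k)

theorem reachable_config (h : π.Initialized) (t : ℕ) (i : Fin k) :
    N.Reachable (π.config t i) := by
  induction t generalizing i with
  | zero => exact .init (h i)
  | succ t ih =>
    obtain ⟨-, hs, hr, hidle⟩ := π.step t
    by_cases h1 : i = π.sender t
    · subst h1
      exact .send (ih _) hs
    · by_cases h2 : i ∈ π.receivers t
      · exact .recv (ih _) (hr i h2) (ih _) hs
      · rw [hidle i h1 h2]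
        exact ih i

/-- Client `i` takes transition `τ` at time `t`. -/
def Takes (t : ℕ) (i : Fin k) (τ : Q × Op D × Q) : Prop :=
  τ.1 = π.config t i ∧ τ.2.2 = π.config (t + 1) i ∧
    (i = π.sender t ∧ τ.2.1 = Op.send (π.msg t) ∨
      i ∈ π.receivers t ∧ τ.2.1 = Op.recv (π.msg t))

/-- The transitions that are taken infinitely often by some client. -/
def recurrent : Set (Q × Op D × Q) :=
  {τ | ∃ i, ∃ᶠ t in atTop, π.Takes t i τ}

variable {π}

theorem Takes.mem_trans {t : ℕ} {i : Fin k} {τ : Q × Op D × Q} (h : π.Takes t i τ) :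
    τ ∈ N.trans := by
  obtain ⟨-, hs, hr, -⟩ := π.step t
  obtain ⟨p, o, q⟩ := τ
  obtain ⟨rfl, rfl, ⟨rfl, rfl⟩ | ⟨hi, rfl⟩⟩ := h
  · exact hs
  · exact hr i hi

theorem Takes.mem_participants {t : ℕ} {i : Fin k} {τ : Q × Op D × Q} (h : π.Takes t i τ) :
    i ∈ π.participants t := by
  obtain ⟨-, -, ⟨rfl, -⟩ | ⟨hi, -⟩⟩ := h
  · exact Finset.mem_insert_self _ _
  · exact Finset.mem_insert_of_mem hi

theorem takes_or_eq (π : N.InfComputation k) (t : ℕ) (i : Fin k) :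
    (∃ o, π.Takes t i (π.config t i, o, π.config (t + 1) i)) ∨
      π.config (t + 1) i = π.config t i := by
  by_cases h1 : i = π.sender t
  · exact .inl ⟨_, rfl, rfl, .inl ⟨h1, rfl⟩⟩
  · by_cases h2 : i ∈ π.receivers t
    · exact .inl ⟨_, rfl, rfl, .inr ⟨h2, rfl⟩⟩
    · exact .inr ((π.step t).2.2.2 i h1 h2)

theorem recurrent_nonempty [Finite D] [Finite Q] (π : N.InfComputation k) :
    π.recurrent.Nonempty := by
  obtain ⟨⟨i, τ⟩, h⟩ := exists_frequently_eq (fun t => (π.sender t,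
    (π.config t (π.sender t), Op.send (π.msg t), π.config (t + 1) (π.sender t))))
    (Frequently.of_forall (f := atTop) (p := fun _ : ℕ => True) fun _ => trivial)
  refine ⟨τ, i, h.mono fun t ht => ?_⟩
  obtain ⟨-, h⟩ := ht
  simp only [Prod.mk.injEq] at h
  obtain ⟨rfl, rfl⟩ := h
  exact ⟨rfl, rfl, .inl ⟨rfl, rfl⟩⟩

/-- A client that takes a transition infinitely often belongs to `Inf(π)`, hence visits `F`
infinitely often. Between two late occurrences of the transition with a visit to `F` in between, it
traces the required closed walk. -/
theorem sustainable_recurrent [Finite D] [Finite Q] {F : Set Q} (h0 : π.Initialized)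
    (h : π.infSet ⊆ π.finSet F) : N.Sustainable F π.recurrent where
  subset := by
    rintro τ ⟨i, hi⟩
    obtain ⟨t, ht⟩ := hi.exists
    exact ht.mem_trans
  reachable := by
    rintro p o q ⟨i, hi⟩
    obtain ⟨t, ht⟩ := hi.exists
    have := ht.1
    dsimp only at this
    rw [this]
    exact reachable_config π h0 t i
  exists_send := by
    rintro p a q ⟨i, hi⟩
    -- Infinitely many of these receives have the same sender, which moves between the same two
    -- states.
    obtain ⟨⟨j, p', q'⟩, h⟩ := exists_frequently_eq (fun t =>
      (π.sender t, π.config t (π.sender t), π.config (t + 1) (π.sender t))) hi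
    refine ⟨p', q', j, h.mono fun t ht => ?_⟩
    obtain ⟨⟨-, -, hm⟩, h⟩ := ht
    simp only [Prod.mk.injEq] at h
    obtain ⟨rfl, rfl, rfl⟩ := h
    refine ⟨rfl, rfl, .inl ⟨rfl, ?_⟩⟩
    simp only [reduceCtorEq, and_false, Op.recv.injEq, false_or] at hm
    rw [hm.2]
  cycle := by
    rintro p o q ⟨i, hi⟩
    have hF : ∃ᶠ t in atTop, π.config t i ∈ F := h (hi.mono fun t ht => ht.mem_participants)
    -- There are finitely many transitions, so a common time exists after which client `i` takes
    -- only recurrent ones.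
    have hev : ∀ᶠ t in atTop, ∀ τ, π.Takes t i τ → τ ∈ π.recurrent := by
      refine eventually_all.2 fun τ => ?_
      by_cases hτ : τ ∈ π.recurrent
      · exact Eventually.of_forall fun _ _ => hτ
      · have : ¬ ∃ᶠ t in atTop, π.Takes t i τ := fun hf => hτ ⟨i, hf⟩
        filter_upwards [not_frequently.1 this] with t ht ht'
        exact absurd ht' ht
    obtain ⟨t₀, ht₀⟩ := eventually_atTop.1 hev
    have walk : ∀ t, t₀ ≤ t → ∀ n,
        ReflTransGen (Edge π.recurrent) (π.config t i) (π.config (t + n) i) := by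
      intro t ht n
      induction n with
      | zero => exact .refl
      | succ n ih =>
        rcases takes_or_eq π (t + n) i with ⟨o, ho⟩ | heq
        · exact ih.tail ⟨o, ht₀ (t + n) (by omega) _ ho⟩
        · rw [← add_assoc, heq]
          exact ih
    obtain ⟨t₁, h1, hp⟩ := frequently_atTop.1 hi t₀
    -- The visit to `F` is sought from `t₁ + 1` on, when the client has arrived in `q`.
    obtain ⟨t₂, h2, hf⟩ := frequently_atTop.1 hF (t₁ + 1)
    obtain ⟨t₃, h3, hq⟩ := frequently_atTop.1 hi t₂
    refine ⟨_, hf, ?_, ?_⟩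
    · have := walk (t₁ + 1) (by omega) (t₂ - (t₁ + 1))
      rwa [Nat.add_sub_cancel' h2, ← hp.2.1] at this
    · have := walk t₂ (by omega) (t₃ - t₂)
      rwa [Nat.add_sub_cancel' h3, ← hq.1] at this

end InfComputation

/-! ### Reachable states can be populated by arbitrarily many clients. -/

/-- There is a transition from `c` to `c'`. -/
def StepRel (N : Network D Q) {k : ℕ} (c c' : Fin k → Q) : Prop :=
  ∃ a i R, N.Step c a i R c'

/-- Some configuration that is reachable from an initial one contains the clients `c`. -/
def Coverable (N : Network D Q) {X : Type} (c : X → Q) : Prop :=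
  ∃ (k : ℕ) (d₀ d : Fin k → Q) (e : X → Fin k), Injective e ∧ (∀ i, d₀ i ∈ N.init) ∧
    ReflTransGen N.StepRel d₀ d ∧ ∀ x, d (e x) = c x

theorem StepRel.cons {k : ℕ} {c c' : Fin k → Q} (h : N.StepRel c c') (q : Q) :
    N.StepRel (Fin.cons q c : Fin (k + 1) → Q) (Fin.cons q c') := by
  obtain ⟨a, i, R, hi, hs, hr, hidle⟩ := h
  refine ⟨a, i.succ, R.map (Fin.succEmb k), ?_, ?_, ?_, ?_⟩
  · simpa using hi
  · simpa using hs
  · intro j hj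
    obtain ⟨j, hj', rfl⟩ := Finset.mem_map.1 hj
    simpa using hr j hj'
  · intro j
    refine Fin.cases (by simp) (fun j h1 h2 => ?_) j
    simpa using hidle j (by simpa using h1) (by simpa using h2)

/-- A derivation of reachability can be replayed by fresh clients without moving those already
present. The family `X` is generalized because a receive needs two fresh clients, one that receives
and one that sends; the sender may be forgotten afterwards. -/
theorem Reachable.coverable {q : Q} (hq : N.Reachable q) {X : Type} {c : X → Q}
    (hc : N.Coverable c) : N.Coverable (fun o : Option X => o.elim q c) := by
  induction hq generalizing X with
  | @init q hq =>
    obtain ⟨k, d₀, d, e, he, h0, hd, hdc⟩ := hc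
    refine ⟨k + 1, Fin.cons q d₀, Fin.cons q d, fun o => o.elim 0 fun x => (e x).succ, ?_, ?_, ?_, ?_⟩
    · rintro (_ | x) (_ | y) h
      · rfl
      · exact absurd h.symm (Fin.succ_ne_zero _)
      · exact absurd h (Fin.succ_ne_zero _)
      · simpa [he.eq_iff] using h
    · intro i
      exact Fin.cases (by simpa using hq) (fun i => by simpa using h0 i) i
    · exact ReflTransGen.lift (p := N.StepRel) (fun d => (Fin.cons q d : Fin (k + 1) → Q))
        (fun _ _ h => StepRel.cons h q) _ _ hd
    · rintro (_ | x) <;> simp [hdc]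
  | @send p q a hp hpq ih =>
    obtain ⟨k, d₀, d, e, he, h0, hd, hdc⟩ := ih hc
    refine ⟨k, d₀, update d (e none) q, e, he, h0, hd.tail ⟨a, e none, ∅, ?_⟩, ?_⟩
    · refine ⟨by simp, ?_, by simp, fun j hj _ => update_of_ne hj _ _⟩
      rw [update_self, hdc]
      exact hpq
    · rintro (_ | x)
      · simp
      · rw [update_of_ne (he.ne (by simp)), hdc]
        rfl
  | @recv p q p' q' a hp hpq hp' hpq' ih ih' =>
    -- Here `none` is the future receiver in state `p` and `some none` is the sender in state `p'`.
    obtain ⟨k, d₀, d, e, he, h0, hd, hdc⟩ := ih (ih' hc)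
    have hne : e none ≠ e (some none) := he.ne (by simp)
    refine ⟨k, d₀, update (update d (e (some none)) q') (e none) q,
      fun o => o.elim (e none) fun x => e (some (some x)), ?_, h0,
      hd.tail ⟨a, e (some none), {e none}, ?_⟩, ?_⟩
    · rintro (_ | x) (_ | y) h
      · rfl
      · simpa using he h
      · simpa using he h
      · simpa using he h
    · refine ⟨by simpa using hne.symm, ?_, ?_, ?_⟩
      · rw [update_of_ne hne.symm, update_self, hdc]
        exact hpq'
      · intro j hj
        rw [Finset.mem_singleton.1 hj, update_self, hdc]
        exact hpq
      · intro j h1 h2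
        rw [update_of_ne (by simpa using h2), update_of_ne h1]
    · rintro (_ | x)
      · simp
      · simp only [Option.elim_some]
        rw [update_of_ne (he.ne (by simp)), update_of_ne (he.ne (by simp)), hdc]
        rfl

theorem coverable_of_reachable {X : Type} [Finite X] (c : X → Q) (hc : ∀ x, N.Reachable (c x)) :
    N.Coverable c := by
  revert c
  refine Finite.induction_empty_option (P := fun X =>
    ∀ c : X → Q, (∀ x, N.Reachable (c x)) → N.Coverable c) ?_ ?_ ?_ X
  · intro X Y e ih c hc
    obtain ⟨k, d₀, d, f, hf, h0, hd, hdc⟩ := ih (fun x => c (e x)) fun x => hc _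
    exact ⟨k, d₀, d, fun y => f (e.symm y), hf.comp e.symm.injective, h0, hd, fun y => by simp [hdc]⟩
  · intro c _
    exact ⟨0, fun i => i.elim0, fun i => i.elim0, fun x => x.elim, fun x => x.elim,
      fun i => i.elim0, .refl, fun x => x.elim⟩
  · intro X _ ih c hc
    have := (hc none).coverable (ih (fun x => c (some x)) fun x => hc _)
    convert this using 1
    funext o
    cases o <;> rfl

/-- A computation starts in `c` in which all clients that participate infinitely often visit `F`
infinitely often. -/
def FairFrom (N : Network D Q) (F : Set Q) {k : ℕ} (c : Fin k → Q) : Prop :=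
  ∃ π : N.InfComputation k, π.config 0 = c ∧ π.infSet ⊆ π.finSet F

theorem frequently_succ {P : ℕ → Prop} :
    (∃ᶠ t in atTop, P (t + 1)) ↔ ∃ᶠ t in atTop, P t := by
  conv_rhs => rw [← map_add_atTop_eq_nat 1]
  rw [frequently_map]

theorem FairFrom.of_step {F : Set Q} {k : ℕ} {c c' : Fin k → Q} (h : N.StepRel c c')
    (h' : N.FairFrom F c') : N.FairFrom F c := by
  obtain ⟨a, i, R, h⟩ := h
  obtain ⟨π, h0, hπ⟩ := h'
  refine ⟨⟨fun t => t.casesOn c fun t => π.config t, fun t => t.casesOn a fun t => π.msg t,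
    fun t => t.casesOn i fun t => π.sender t, fun t => t.casesOn R fun t => π.receivers t,
    fun t => ?_⟩, rfl, ?_⟩
  · cases t with
    | zero =>
      simp only [h0]
      exact h
    | succ t => exact π.step t
  · intro j hj
    have : j ∈ π.infSet := frequently_succ.2 hj
    exact frequently_succ.1 (hπ this)

theorem FairFrom.of_steps {F : Set Q} {k : ℕ} {c c' : Fin k → Q}
    (h : ReflTransGen N.StepRel c c') (h' : N.FairFrom F c') : N.FairFrom F c := by
  induction h using ReflTransGen.head_induction_on with
  | refl => exact h'
  | head hstep _ ih => exact ih.of_step hstep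

/-! ### Carousels: clients that circulate forever. -/

/-- A finite family of clients with a permutation such that all clients can move on to the state
of the next one. -/
structure Carousel (N : Network D Q) (F : Set Q) (X : Type) where
  next : Equiv.Perm X
  src : X → Q
  op : X → Op D
  mem_trans : ∀ x, (src x, op x, src (next x)) ∈ N.trans
  exists_send : ∀ x a, op x = Op.recv a → ∃ y, op y = Op.send a
  reachable : ∀ x, N.Reachable (src x)
  frequently : ∀ x, ∃ᶠ r in atTop, src ((next ^ r) x) ∈ F

namespace Carousel

variable {F : Set Q} {X : Type} [Fintype X] (C : N.Carousel F X)

/-- The positions at which a message is sent. -/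
abbrev Sender : Type := {x : X // ∃ a, C.op x = Op.send a}

omit [Fintype X] in
theorem exists_partner (x : X) : ∃ y : C.Sender, C.op x = C.op y ∨
    ∃ a, C.op x = Op.recv a ∧ C.op y = Op.send a := by
  cases h : C.op x with
  | send a => exact ⟨⟨x, a, h⟩, .inl h.symm⟩
  | recv a =>
    obtain ⟨y, hy⟩ := C.exists_send x a h
    exact ⟨⟨y, a, hy⟩, .inr ⟨a, rfl, hy⟩⟩

open Classical in
/-- The sender with which position `x` moves. -/
noncomputable def partner (x : X) : C.Sender :=
  if h : ∃ a, C.op x = Op.send a then ⟨x, h⟩ else (C.exists_partner x).choose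

omit [Fintype X] in
theorem partner_sender (x : C.Sender) : C.partner x = x := by
  simp [partner, x.2]

omit [Fintype X] in
theorem op_of_partner {x : X} {y : C.Sender} (h : C.partner x = y) :
    x = y ∨ ∃ a, C.op x = Op.recv a ∧ C.op y = Op.send a := by
  by_cases hx : ∃ a, C.op x = Op.send a
  · left
    rw [← h, partner, dif_pos hx]
  · rw [partner, dif_neg hx] at h
    subst h
    refine .inr ((C.exists_partner x).choose_spec.resolve_left fun h => hx ?_)
    obtain ⟨a, ha⟩ := (C.exists_partner x).choose.2
    exact ⟨a, h.trans ha⟩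

open Classical in
/-- The number of the phase in which position `x` moves during a round. -/
noncomputable def phase (x : X) : Fin (Fintype.card C.Sender) :=
  Fintype.equivFin C.Sender (C.partner x)

open Classical in
/-- Once a configuration contains a client at each position, the positions move forever. -/
theorem fairFrom [Nonempty X] {k : ℕ} (d : Fin k → Q) (e : X → Fin k) (he : Injective e)
    (hd : ∀ x, d (e x) = C.src x) : N.FairFrom F d := by
  set m := Fintype.card C.Sender with hm
  have hm0 : 0 < m := (C.phase (Classical.arbitrary X)).pos
  let sender : ℕ → C.Sender := fun t =>
    (Fintype.equivFin C.Sender).symm ⟨t % m, Nat.mod_lt _ hm0⟩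
  have hphase : ∀ t x, (C.phase x : ℕ) = t % m ↔ C.partner x = sender t := by
    intro t x
    rw [phase, Equiv.eq_symm_apply, Fin.ext_iff]
  -- The state of client `x` in round `r` after `s` phases. It starts the round at position `next ^
  -- r` of `x` and has advanced as soon as the phase of that position is over.
  let at' : ℕ → ℕ → X → Q := fun r s x =>
    if (C.phase ((C.next ^ r) x) : ℕ) < s then C.src (C.next ((C.next ^ r) x))
    else C.src ((C.next ^ r) x)
  have hround : ∀ r x, at' r m x = at' (r + 1) 0 x := by
    intro r x
    have hlt : (C.phase ((C.next ^ r) x) : ℕ) < m := (C.phase _).isLt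
    simp only [at', if_pos hlt, Nat.not_lt_zero, if_false, pow_succ']
    rfl
  -- Time `t` is phase `t % m` of round `t / m`. Clients outside the range of `e` keep their states
  -- in `d` forever.
  let config : ℕ → Fin k → Q := fun t => Function.extend e (at' (t / m) (t % m)) d
  have hnext : ∀ t, config (t + 1) = Function.extend e (at' (t / m) (t % m + 1)) d := by
    intro t
    simp only [config]
    congr 1
    funext x
    have hlt := Nat.mod_lt t hm0
    rcases Nat.lt_or_ge (t % m + 1) m with h | h
    · have h1 : (t + 1) % m = t % m + 1 := by
        rw [Nat.add_mod, Nat.mod_eq_of_lt (show 1 < m by omega), Nat.mod_eq_of_lt h]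
      have h2 : (t + 1) / m = t / m := by
        rw [Nat.succ_div, if_neg (by rw [Nat.dvd_iff_mod_eq_zero, h1]; omega)]
        rfl
      rw [h1, h2]
    · have h0 : t % m + 1 = m := by omega
      have h3 : t + 1 = m * (t / m + 1) := by
        have := Nat.div_add_mod t m
        rw [Nat.mul_succ]
        omega
      rw [h0, hround, h3, Nat.mul_mod_right, Nat.mul_div_cancel_left _ hm0]
  have hval : ∀ t x, config t (e x) = at' (t / m) (t % m) x := fun t x => he.extend_apply _ _ _
  have hvaln : ∀ t x, config (t + 1) (e x) = at' (t / m) (t % m + 1) x := fun t x => by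
    rw [hnext, he.extend_apply]
  have hmove : ∀ t x, C.partner ((C.next ^ (t / m)) x) = sender t →
      (config t (e x), C.op ((C.next ^ (t / m)) x), config (t + 1) (e x)) ∈ N.trans := by
    intro t x hx
    rw [hvaln, hval]
    simp only [at', (hphase _ _).2 hx, lt_irrefl, if_false, Nat.lt_succ_self, if_true]
    exact C.mem_trans _
  have hstay : ∀ t j, (∀ x, e x = j → C.partner ((C.next ^ (t / m)) x) ≠ sender t) →
      config (t + 1) j = config t j := by
    intro t j hj
    by_cases h : ∃ x, e x = j
    · obtain ⟨x, rfl⟩ := h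
      have := mt (hphase t _).1 (hj x rfl)
      rw [hvaln, hval]
      simp only [at']
      congr 1
      simp only [eq_iff_iff]
      omega
    · rw [hnext]
      simp only [config, Function.extend_apply' _ _ _ h]
  -- The client that occupies the current send position in the current round.
  let client : ℕ → X := fun t => (C.next ^ (t / m)).symm (sender t)
  have hclient : ∀ t, (C.next ^ (t / m)) (client t) = sender t := fun t =>
    Equiv.apply_symm_apply _ _
  choose msg hmsg using fun t => (sender t).2
  let π : N.InfComputation k := {
    config := config
    msg := msg
    sender := fun t => e (client t)
    receivers := fun t => {j | j ≠ e (client t) ∧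
      ∃ x, e x = j ∧ C.partner ((C.next ^ (t / m)) x) = sender t}
    step := fun t => by
      refine ⟨by simp, ?_, ?_, ?_⟩
      · have := hmove t (client t) (by rw [hclient, partner_sender])
        rwa [hclient, hmsg] at this
      · intro j hj
        simp only [Finset.mem_filter, Finset.mem_univ, true_and] at hj
        obtain ⟨hne, x, rfl, hx⟩ := hj
        have := hmove t x hx
        rcases C.op_of_partner hx with h | ⟨a, h1, h2⟩
        · refine absurd ?_ hne
          rw [← hclient] at h
          rw [(C.next ^ (t / m)).injective h]
        · rw [hmsg] at h2
          cases h2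
          rwa [h1] at this
      · intro j h1 h2
        refine hstay t j fun x hx hp => h2 ?_
        simp only [Finset.mem_filter, Finset.mem_univ, true_and]
        exact ⟨h1, x, hx, hp⟩ }
  refine ⟨π, ?_, ?_⟩
  · funext j
    by_cases h : ∃ x, e x = j
    · obtain ⟨x, rfl⟩ := h
      rw [hd]
      simp [π, hval, at']
    · simp only [π, config, Function.extend_apply' _ _ _ h]
  · intro j hj
    obtain ⟨t, ht⟩ := hj.exists
    -- Clients outside the range of `e` never participate, so the fairness condition does not
    -- concern them.
    obtain ⟨x, rfl⟩ : ∃ x, e x = j := by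
      rcases Finset.mem_insert.1 ht with h | h
      · exact ⟨_, h.symm⟩
      · simp only [π, Finset.mem_filter, Finset.mem_univ, true_and] at h
        obtain ⟨-, x, hx, -⟩ := h
        exact ⟨x, hx⟩
    refine frequently_atTop.2 fun t₀ => ?_
    obtain ⟨r, hr, hF⟩ := frequently_atTop.1 (C.frequently x) t₀
    -- Round `r` begins at time `m * r`, when all clients stand exactly at their positions.
    refine ⟨m * r, hr.trans (Nat.le_mul_of_pos_left _ hm0), ?_⟩
    simp only [π, hval, at', Nat.mul_mod_right, Nat.mul_div_cancel_left _ hm0, Nat.not_lt_zero,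
      if_false]
    exact hF

theorem hasFairComputation [Nonempty X] (C : N.Carousel F X) : N.HasFairComputation F := by
  obtain ⟨k, d₀, d, e, he, h0, hd, hde⟩ := coverable_of_reachable C.src C.reachable
  obtain ⟨π, hπ0, hπ⟩ := (C.fairFrom d e he hde).of_steps hd
  exact ⟨k, π, fun i => by rw [hπ0]; exact h0 i, hπ⟩

end Carousel

/-! ### Sustainable sets give fair computations. -/

/-- A sequence of `n` steps of a relation. -/
theorem exists_seq_of_reflTransGen {α : Type*} {r : α → α → Prop} {x y : α}
    (h : ReflTransGen r x y) :
    ∃ (n : ℕ) (g : ℕ → α), g 0 = x ∧ g n = y ∧ ∀ i < n, r (g i) (g (i + 1)) := by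
  induction h using ReflTransGen.head_induction_on with
  | refl => exact ⟨0, fun _ => y, rfl, rfl, by simp⟩
  | @head x z hxz _ ih =>
    obtain ⟨n, g, h0, hn, hg⟩ := ih
    refine ⟨n + 1, fun i => i.casesOn x g, rfl, hn, fun i hi => ?_⟩
    cases i with
    | zero =>
      simp only [h0]
      exact hxz
    | succ i => exact hg i (by omega)

/-- Every transition of a sustainable set lies on a closed walk through `F`. -/
theorem Sustainable.exists_closed_walk {F : Set Q} {T : Set (Q × Op D × Q)}
    (h : N.Sustainable F T) {p q : Q} {o : Op D} (hT : (p, o, q) ∈ T) :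
    ∃ (n : ℕ) (g : ℕ → Q) (l : ℕ → Op D), g 0 ∈ F ∧ g (n + 1) = g 0 ∧
      (∀ i ≤ n, (g i, l i, g (i + 1)) ∈ T) ∧ ∃ i ≤ n, l i = o := by
  classical
  obtain ⟨f, hf, hqf, hfp⟩ := h.cycle hT
  obtain ⟨n, g, hg0, hgn, hg⟩ := exists_seq_of_reflTransGen hfp
  obtain ⟨m, g', hg0', hgm', hg'⟩ := exists_seq_of_reflTransGen hqf
  -- The walk leads from `f` to `p` in `n` steps, takes the given transition, and returns from `q`
  -- to `f` in `m` steps.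
  let w : ℕ → Q := fun i => if i ≤ n then g i else g' (i - (n + 1))
  -- Several transitions may join the same two states, so the operation at step `n` is required to
  -- be `o`.
  have hw : ∀ i ≤ n + m, ∃ l, (w i, l, w (i + 1)) ∈ T ∧ (i = n → l = o) := by
    intro i hi
    rcases lt_trichotomy i n with hin | rfl | hin
    · obtain ⟨l, hl⟩ := hg i hin
      refine ⟨l, ?_, fun h => by omega⟩
      simpa only [w, hin.le, if_true, show i + 1 ≤ n by omega] using hl
    · refine ⟨o, ?_, fun _ => rfl⟩
      simp only [w, le_refl, if_true, show ¬ i + 1 ≤ i by omega, if_false, Nat.sub_self, hgn, hg0']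
      exact hT
    · obtain ⟨l, hl⟩ := hg' (i - (n + 1)) (by omega)
      refine ⟨l, ?_, fun h => by omega⟩
      simp only [w, show ¬ i ≤ n by omega, show ¬ i + 1 ≤ n by omega, if_false]
      rwa [show i + 1 - (n + 1) = i - (n + 1) + 1 by omega]
  have : Nonempty (Op D) := ⟨o⟩
  choose! l hl using hw
  refine ⟨n + m, w, l, ?_, ?_, fun i hi => (hl i hi).1, n, by omega, (hl n (by omega)).2 rfl⟩
  · simp only [w, Nat.zero_le, if_true, hg0]
    exact hf
  · simp only [w, Nat.zero_le, if_true, hg0, show ¬ n + m + 1 ≤ n by omega, if_false,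
      show n + m + 1 - (n + 1) = m by omega, hgm']

/-- The carousel consists of one closed walk per transition of `T`, each rotated by one position. A
receive on a walk has a matching send in `T`, and the walk chosen for that send contains it. -/
theorem Sustainable.hasFairComputation [Finite D] [Finite Q] {F : Set Q}
    {T : Set (Q × Op D × Q)} (h : N.Sustainable F T) (hT : T.Nonempty) :
    N.HasFairComputation F := by
  have hfin : Fintype T := Fintype.ofFinite T
  choose n g l hgF hg hl i₀ hi₀ hli₀ using fun τ : T =>
    h.exists_closed_walk (p := τ.1.1) (o := τ.1.2.1) (q := τ.1.2.2) τ.2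
  -- Addition in `Fin (n τ + 1)` wraps from the last position to the first, in agreement with the
  -- closedness of the walk.
  have hval : ∀ (τ : T) (i : Fin (n τ + 1)), g τ (i + 1 : Fin (n τ + 1)) = g τ (i + 1) := by
    intro τ i
    rw [Fin.val_add_one]
    split_ifs with hi
    · rw [hi, Fin.val_last, hg]
    · rfl
  let C : N.Carousel F ((τ : T) × Fin (n τ + 1)) := {
    next := Equiv.sigmaCongrRight fun τ => Equiv.addRight 1
    src := fun x => g x.1 x.2
    op := fun x => l x.1 x.2
    mem_trans := fun ⟨τ, i⟩ => by
      have := h.subset (hl τ i (by omega))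
      rw [← hval] at this
      exact this
    exists_send := fun ⟨τ, i⟩ a ha => by
      have := hl τ i (by omega)
      dsimp only at ha
      rw [ha] at this
      obtain ⟨p', q', hs⟩ := h.exists_send this
      exact ⟨⟨⟨_, hs⟩, ⟨i₀ ⟨_, hs⟩, Nat.lt_succ_of_le (hi₀ _)⟩⟩, hli₀ ⟨_, hs⟩⟩
    reachable := fun ⟨τ, i⟩ => h.reachable (hl τ i (by omega))
    frequently := fun ⟨τ, i⟩ => by
      have hpow : ∀ r : ℕ, ((Equiv.sigmaCongrRight fun τ : T =>
          Equiv.addRight (1 : Fin (n τ + 1))) ^ r) ⟨τ, i⟩ = ⟨τ, i + Fin.ofNat (n τ + 1) r⟩ := by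
        intro r
        induction r with
        | zero => simp
        | succ r ih =>
          rw [pow_succ', Equiv.Perm.mul_apply, ih]
          simp only [Equiv.sigmaCongrRight_apply, Equiv.coe_addRight,
            Sigma.mk.injEq, heq_eq_eq, true_and]
          apply Fin.ext
          simp only [Fin.val_add, Fin.val_ofNat, Fin.val_one', Nat.add_mod_mod, Nat.mod_add_mod,
            add_assoc]
      -- This number of rotations takes position `i` to position 0, which lies in `F`, and it is at
      -- least `t`.
      refine frequently_atTop.2 fun t => ⟨(n τ + 1) * t + (n τ + 1 - i), ?_, ?_⟩
      · nlinarith [Nat.zero_le (n τ * t)]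
      · rw [hpow]
        have : i + Fin.ofNat (n τ + 1) ((n τ + 1) * t + (n τ + 1 - i)) = 0 := by
          apply Fin.ext
          rw [Fin.val_add, Fin.val_ofNat, Nat.add_mod_mod,
            show (i : ℕ) + ((n τ + 1) * t + (n τ + 1 - i)) = (n τ + 1) * (t + 1) by
              rw [Nat.mul_succ]
              omega]
          simp
        dsimp only
        rw [this]
        exact hgF τ }
  have : Nonempty ((τ : T) × Fin (n τ + 1)) := ⟨⟨⟨_, hT.some_mem⟩, 0⟩⟩
  exact C.hasFairComputation

theorem hasFairComputation_iff [Finite D] [Finite Q] {F : Set Q} :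
    N.HasFairComputation F ↔ ∃ T : Set (Q × Op D × Q), T.Nonempty ∧ N.Sustainable F T :=
  ⟨fun ⟨_, π, h0, h⟩ => ⟨π.recurrent, π.recurrent_nonempty,
    InfComputation.sustainable_recurrent h0 h⟩, fun ⟨_, hT, h⟩ => h.hasFairComputation hT⟩

/-- A homomorphism of networks maps fair computations to fair computations. -/
theorem HasFairComputation.map {D' Q' : Type} {N' : Network D' Q'} {F : Set Q} {F' : Set Q'}
    (h : N.HasFairComputation F) (f : Q → Q') (g : D → D')
    (hinit : ∀ q ∈ N.init, f q ∈ N'.init) (hF : ∀ q ∈ F, f q ∈ F')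
    (hsend : ∀ p a q, (p, Op.send a, q) ∈ N.trans → (f p, Op.send (g a), f q) ∈ N'.trans)
    (hrecv : ∀ p a q, (p, Op.recv a, q) ∈ N.trans → (f p, Op.recv (g a), f q) ∈ N'.trans) :
    N'.HasFairComputation F' := by
  obtain ⟨k, π, h0, h⟩ := h
  refine ⟨k, ⟨fun t i => f (π.config t i), fun t => g (π.msg t), π.sender, π.receivers,
    fun t => ?_⟩, fun i => hinit _ (h0 i), fun i hi => ?_⟩
  · obtain ⟨h1, h2, h3, h4⟩ := π.step t
    exact ⟨h1, hsend _ _ _ h2, fun j hj => hrecv _ _ _ (h3 j hj),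
      fun j hj hj' => congrArg f (h4 j hj hj')⟩
  · have : i ∈ π.finSet F := h hi
    exact this.mono fun t ht => hF _ ht

end Network

end BroadcastNet

/-! ### Rules: table programs that amend a table by a definable set. -/

open Turing Function

namespace FairDecider

/-- The phases of the parser: it reads the numbers of states and messages, then the items of the
three lists. An item of the transition list consists of a source, an operation, a message and a
target. -/
inductive Phase
  | states
  | msgs
  | initHead
  | initNum
  | finHead
  | finNum
  | transHead
  | source
  | operation
  | msg (isSend : Bool)
  | target (isSend : Bool)
  | finished
  deriving Fintype

/-- The control states: a phase of the parser and three bits that were read from tables. -/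
structure Reg where
  phase : Phase
  b₁ : Bool
  b₂ : Bool
  b₃ : Bool
  deriving Fintype

/-- The tables: the input, the sets of states `ini`, `fin`, the sets of transitions `snd`, `rcv`,
and auxiliary ones. Sets `A` are represented by `(x, x, x)` with `x ∈ A`, binary relations `R`
by `(x, y, y)` with `R x y`. -/
inductive Tab
  | inp
  | ini
  | fin
  | snd
  | rcv
  | sendable
  | aux
  | walk
  | ok
  | res
  deriving DecidableEq

instance : Fintype Tab :=
  Fintype.ofList [.inp, .ini, .fin, .snd, .rcv, .sendable, .aux, .walk, .ok, .res]
    (by intro t; cases t <;> simp)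

/-- The variables: `zero` is constantly zero, `idx` is the position of the parser. -/
inductive Var
  | zero
  | idx
  | x
  | p
  | a
  | q
  deriving DecidableEq

instance : Fintype Var :=
  Fintype.ofList [.zero, .idx, .x, .p, .a, .q] (by intro v; cases v <;> simp)

abbrev Prog := TableProg Tab Var Reg

abbrev Tables (L : ℕ) := Tab → Set (Fin L × Fin L × Fin L)

/-- The control state between the parts of the program. -/
def Reg.idle : Reg := ⟨.states, false, false, false⟩

variable {L : ℕ} [NeZero L]

open TableProg

/-- Add a set to a table or remove it. -/
def amend {α : Type*} (b : Bool) (A S : Set α) : Set α :=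
  bif b then A ∪ S else A \ S

theorem amend_amend {α : Type*} (b : Bool) (A S S' : Set α) :
    amend b (amend b A S) S' = amend b A (S ∪ S') := by
  cases b
  · simp [amend, Set.sdiff_sdiff]
  · simp [amend, Set.union_assoc]

/-- The effect of `p` is to add the set `S` to table `t` or to remove it. The set does not depend
on table `t`. -/
def IsRule (L : ℕ) [NeZero L] (p : Prog) (t : Tab) (b : Bool)
    (S : (Var → Fin L) → Tables L → Set (Fin L × Fin L × Fin L)) : Prop :=
  (∀ v r τ, r = Reg.idle → run p ⟨r, v, τ⟩ = ⟨r, v, update τ t (amend b (τ t) (S v τ))⟩) ∧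
    ∀ v τ A, S v (update τ t A) = S v τ

/-- Increments modulo `L` let `y` run through all values from any start and return to it. As the
amended set does not depend on table `t`, earlier rounds do not influence later ones, and the sets
just unite. -/
theorem IsRule.loop {p : Prog} {t : Tab} {b : Bool}
    {S : (Var → Fin L) → Tables L → Set (Fin L × Fin L × Fin L)} (h : IsRule L p t b S)
    (y : Var) :
    IsRule L (.loop (.seq p (.incr y))) t b (fun v τ => {i | ∃ j, i ∈ S (update v y j) τ}) := by
  refine ⟨fun v r τ hr => ?_, fun v τ A => by simp only [h.2]⟩
  have key : ∀ n : ℕ, (run (L := L) (.seq p (.incr y)))^[n] ⟨r, v, τ⟩ =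
      ⟨r, update v y (v y + Fin.ofNat L n), update τ t (amend b (τ t)
        {i | ∃ m < n, i ∈ S (update v y (v y + Fin.ofNat L m)) τ})⟩ := by
    intro n
    induction n with
    | zero =>
      have : amend b (τ t) (∅ : Set (Fin L × Fin L × Fin L)) = τ t := by cases b <;> simp [amend]
      simp [this]
    | succ n ih =>
      rw [iterate_succ_apply', ih]
      simp only [run, h.1 _ _ _ hr, update_self, update_idem, amend_amend, h.2, TableState.mk.injEq,
        true_and]
      refine ⟨?_, ?_⟩
      · congr 1
        apply Fin.ext
        simp only [Fin.val_add, Fin.val_ofNat, Fin.val_one', Nat.add_mod_mod, Nat.mod_add_mod,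
          add_assoc]
      · congr 2
        ext i
        simp only [Set.mem_union, Set.mem_ofPred_eq, Nat.lt_succ_iff_lt_or_eq]
        constructor
        · rintro (⟨m, hm, hi⟩ | hi)
          · exact ⟨m, .inl hm, hi⟩
          · exact ⟨n, .inr rfl, hi⟩
        · rintro ⟨m, hm | rfl, hi⟩
          · exact .inl ⟨m, hm, hi⟩
          · exact .inr hi
  rw [run, key L]
  have h1 : v y + Fin.ofNat L L = v y := by
    apply Fin.ext
    simp
  rw [h1, update_eq_self]
  congr 3
  ext i
  constructor
  · rintro ⟨m, -, hi⟩
    exact ⟨_, hi⟩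
  · rintro ⟨j, hi⟩
    refine ⟨(j - v y : Fin L), (j - v y).isLt, ?_⟩
    have : v y + Fin.ofNat L (j - v y : Fin L) = j := by
      rw [Fin.ofNat_val_eq_self]
      abel
    rwa [this]

/-- The values of three variables. -/
def val (v : Var → Fin L) (x : Var × Var × Var) : Fin L × Fin L × Fin L :=
  (v x.1, v x.2.1, v x.2.2)

/-- The valuation that is used in rules. -/
def valuation (x p a q : Fin L) : Var → Fin L
  | .zero => 0
  | .idx => 0
  | .x => x
  | .p => p
  | .a => a
  | .q => q

/-- If condition `g` holds for the bits at `r₁`, `r₂` and `r₃`, then set the bit at `w` to `b`. -/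
def update₁ (r₁ r₂ r₃ : Tab × Var × Var × Var) (g : Bool → Bool → Bool → Bool)
    (w : Tab × Var × Var × Var) (b : Bool) : Prog :=
  .seq (.read r₁.1 r₁.2.1 r₁.2.2.1 r₁.2.2.2 fun v c => { v with b₁ := c })
    (.seq (.read r₂.1 r₂.2.1 r₂.2.2.1 r₂.2.2.2 fun v c => { v with b₂ := c })
      (.seq (.read r₃.1 r₃.2.1 r₃.2.2.1 r₃.2.2.2 fun v c => { v with b₃ := c })
        (.seq (.ite (fun v => g v.b₁ v.b₂ v.b₃) (.write w.1 w.2.1 w.2.2.1 w.2.2.2 b) (.assign id))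
          (.assign fun _ => Reg.idle))))

theorem isRule_update₁ {r₁ r₂ r₃ w : Tab × Var × Var × Var} {g : Bool → Bool → Bool → Bool}
    {b : Bool} (h₁ : r₁.1 ≠ w.1) (h₂ : r₂.1 ≠ w.1) (h₃ : r₃.1 ≠ w.1) :
    IsRule L (update₁ r₁ r₂ r₃ g w b) w.1 b (fun v τ => {i | i = val v w.2 ∧
      g (bit (val v r₁.2 ∈ τ r₁.1)) (bit (val v r₂.2 ∈ τ r₂.1))
        (bit (val v r₃.2 ∈ τ r₃.1)) = true}) := by
  refine ⟨fun v r τ hr => ?_, fun v τ A => by simp [h₁, h₂, h₃]⟩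
  subst hr
  simp only [update₁, run, val]
  cases hg : g (bit ((v r₁.2.1, v r₁.2.2.1, v r₁.2.2.2) ∈ τ r₁.1))
    (bit ((v r₂.2.1, v r₂.2.2.1, v r₂.2.2.2) ∈ τ r₂.1))
    (bit ((v r₃.2.1, v r₃.2.2.1, v r₃.2.2.2) ∈ τ r₃.1))
  · cases b <;> simp [amend]
  · cases b
    · simp [amend]
    · simp [amend]

/-- Apply `update₁` for all values of the variables. -/
def rule (r₁ r₂ r₃ : Tab × Var × Var × Var) (g : Bool → Bool → Bool → Bool)
    (w : Tab × Var × Var × Var) (b : Bool) : Prog :=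
  .loop (.seq (.loop (.seq (.loop (.seq (.loop (.seq (update₁ r₁ r₂ r₃ g w b) (.incr .q)))
    (.incr .a))) (.incr .p))) (.incr .x))

/-- The effect of a program on the tables, when all variables are zero at the beginning. -/
def Computes (L : ℕ) [NeZero L] (p : Prog) (f : Tables L → Tables L) : Prop :=
  ∀ τ, run p ⟨Reg.idle, fun _ => 0, τ⟩ = ⟨Reg.idle, fun _ => 0, f τ⟩

theorem Computes.seq {p p' : Prog} {f f' : Tables L → Tables L} (h : Computes L p f)
    (h' : Computes L p' f') : Computes L (.seq p p') (fun τ => f' (f τ)) := by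
  intro τ
  simp only [run, h τ, h' (f τ)]

theorem Computes.loop {p : Prog} {f : Tables L → Tables L} (h : Computes L p f) :
    Computes L (.loop p) f^[L] := by
  intro τ
  have : ∀ n : ℕ, (run (L := L) p)^[n] ⟨Reg.idle, fun _ => 0, τ⟩ =
      ⟨Reg.idle, fun _ => 0, f^[n] τ⟩ := by
    intro n
    induction n with
    | zero => rfl
    | succ n ih => rw [iterate_succ_apply', iterate_succ_apply', ih, h]
  exact this L

/-- The effect of a rule on the tables. -/
noncomputable def ruleMap (r₁ r₂ r₃ : Tab × Var × Var × Var) (g : Bool → Bool → Bool → Bool)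
    (w : Tab × Var × Var × Var) (b : Bool) (τ : Tables L) : Tables L :=
  update τ w.1 (amend b (τ w.1) {i | ∃ x p a q, i = val (valuation x p a q) w.2 ∧
    g (bit (val (valuation x p a q) r₁.2 ∈ τ r₁.1))
      (bit (val (valuation x p a q) r₂.2 ∈ τ r₂.1))
      (bit (val (valuation x p a q) r₃.2 ∈ τ r₃.1)) = true})

theorem update_valuation (x p a q : Fin L) :
    update (update (update (update (fun _ => 0) .x x) .p p) .a a) .q q = valuation x p a q := by
  funext v
  cases v <;> simp [valuation]

/-- A rule must not read the table that it writes. This is why the fixed point iterations below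
collect new elements in `aux` before they copy them. -/
theorem computes_rule {r₁ r₂ r₃ w : Tab × Var × Var × Var} {g : Bool → Bool → Bool → Bool}
    {b : Bool} (h₁ : r₁.1 ≠ w.1) (h₂ : r₂.1 ≠ w.1) (h₃ : r₃.1 ≠ w.1) :
    Computes L (rule r₁ r₂ r₃ g w b) (ruleMap r₁ r₂ r₃ g w b) := by
  intro τ
  have := (((isRule_update₁ (L := L) (g := g) (b := b) h₁ h₂ h₃).loop .q).loop .a).loop .p |>.loop .x
  rw [rule, this.1 _ _ _ rfl]
  simp only [Set.mem_ofPred_eq, update_valuation]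
  rfl

/-- A chain in a finite type cannot grow strictly `N + 1` times, so it stalls at some index up to
`N`. Thus a fixed number of rounds replaces a test for stabilization, and completeness of an
iteration need only be shown where it stalls. -/
theorem subset_of_chain {α : Type*} [Finite α] {S : ℕ → Set α} (hS : ∀ n, S n ⊆ S (n + 1))
    {C : Set α} (h : ∀ n, S (n + 1) ⊆ S n → C ⊆ S n) {N : ℕ} (hN : Nat.card α ≤ N) : C ⊆ S N := by
  by_contra hC
  have mono : Monotone S := monotone_nat_of_le_succ hS
  have key : ∀ n ≤ N + 1, n ≤ (S n).ncard := by
    intro n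
    induction n with
    | zero => simp
    | succ n ih =>
      intro hn
      have hlt : S n ⊂ S (n + 1) :=
        ⟨hS n, fun h' => hC ((h n h').trans (mono (by omega)))⟩
      have := Set.ncard_lt_ncard hlt (Set.toFinite _)
      have := ih (by omega)
      omega
  have h1 := key (N + 1) le_rfl
  have h2 := Set.ncard_le_card (S (N + 1))
  omega

/-- A rule always inspects three bits; rules with fewer conditions repeat an entry or ignore a bit.
-/
def both (a b _ : Bool) : Bool := a && b

def all (a b c : Bool) : Bool := a && b && c

open BroadcastNet BroadcastNet.Network

/-- The set that a table represents. -/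
def un (τ : Tables L) (t : Tab) : Set (Fin L) :=
  {q | (q, q, q) ∈ τ t}

/-- The transition relation that is stored in the tables. -/
def trans (τ : Tables L) : Set (Fin L × Op (Fin L) × Fin L) :=
  {i | match i.2.1 with
    | .send a => (i.1, a, i.2.2) ∈ τ .snd
    | .recv a => (i.1, a, i.2.2) ∈ τ .rcv}

/-- The network that is stored in the tables. -/
def netOf (τ : Tables L) : Network (Fin L) (Fin L) where
  init := un τ .ini
  trans := trans τ

omit [NeZero L] in
@[simp]
theorem send_mem_trans {τ : Tables L} {p a q : Fin L} :
    (p, Op.send a, q) ∈ trans τ ↔ (p, a, q) ∈ τ .snd :=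
  Iff.rfl

omit [NeZero L] in
@[simp]
theorem recv_mem_trans {τ : Tables L} {p a q : Fin L} :
    (p, Op.recv a, q) ∈ trans τ ↔ (p, a, q) ∈ τ .rcv :=
  Iff.rfl

/-! ### Computing the reachable states. -/

/-- Add the successors of initial states to the initial states. -/
def reachStep : Prog :=
  .seq (rule (.snd, .p, .a, .q) (.ini, .p, .p, .p) (.snd, .p, .a, .q) both
      (.sendable, .a, .a, .a) true)
    (.seq (rule (.snd, .p, .a, .q) (.ini, .p, .p, .p) (.snd, .p, .a, .q) both
      (.aux, .q, .q, .q) true)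
    (.seq (rule (.rcv, .p, .a, .q) (.ini, .p, .p, .p) (.sendable, .a, .a, .a) all
      (.aux, .q, .q, .q) true)
    (rule (.aux, .q, .q, .q) (.aux, .q, .q, .q) (.aux, .q, .q, .q) both (.ini, .q, .q, .q) true)))

theorem exists_computes_reachStep : ∃ f : Tables L → Tables L, Computes L reachStep f ∧
    ∀ τ, (∀ a, (a, a, a) ∈ f τ .sendable ↔ (a, a, a) ∈ τ .sendable ∨
        ∃ p q, (p, a, q) ∈ τ .snd ∧ (p, p, p) ∈ τ .ini) ∧
      (∀ q, (q, q, q) ∈ f τ .aux ↔ ((q, q, q) ∈ τ .aux ∨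
        ∃ p a, (p, a, q) ∈ τ .snd ∧ (p, p, p) ∈ τ .ini) ∨
        ∃ p a, ((p, a, q) ∈ τ .rcv ∧ (p, p, p) ∈ τ .ini) ∧ (a, a, a) ∈ f τ .sendable) ∧
      (∀ q, (q, q, q) ∈ f τ .ini ↔ (q, q, q) ∈ τ .ini ∨ (q, q, q) ∈ f τ .aux) ∧
      ∀ t, t ≠ .sendable → t ≠ .aux → t ≠ .ini → f τ t = τ t := by
  refine ⟨_, (computes_rule (by decide) (by decide) (by decide)).seq
    ((computes_rule (by decide) (by decide) (by decide)).seq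
    ((computes_rule (by decide) (by decide) (by decide)).seq
    (computes_rule (by decide) (by decide) (by decide)))), fun τ => ⟨?_, ?_, ?_, ?_⟩⟩
  · intro a
    simp [ruleMap, amend, both, val, valuation]
  · intro a
    simp [ruleMap, amend, both, all, val, valuation]
  · intro a
    simp [ruleMap, amend, both, all, val, valuation]
  · intro t h1 h2 h3
    simp [ruleMap, h1, h2, h3]

/-- Table `ini` grows from the initial to the reachable states. Soundness is an invariant of
`sendable`, `aux` and `ini` together. These tables are never cleared in between, which is harmless
because they only grow. For completeness, `L` rounds suffice since `ini` represents a subset of `Fin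
L`. -/
theorem exists_computes_reach : ∃ f : Tables L → Tables L, Computes L (.loop reachStep) f ∧
    ∀ τ, τ .sendable = ∅ → τ .aux = ∅ → un (f τ) .ini = {q | (netOf τ).Reachable q} ∧
      ∀ t, t ≠ .sendable → t ≠ .aux → t ≠ .ini → f τ t = τ t := by
  obtain ⟨f, hf, h⟩ := exists_computes_reachStep (L := L)
  refine ⟨_, hf.loop, fun τ h1 h2 => ?_⟩
  have other : ∀ n t, t ≠ .sendable → t ≠ .aux → t ≠ .ini → f^[n] τ t = τ t := by
    intro n t h3 h4 h5
    induction n with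
    | zero => rfl
    | succ n ih => rw [iterate_succ_apply', (h _).2.2.2 t h3 h4 h5, ih]
  have hsnd n : f^[n] τ .snd = τ .snd := other n .snd (by decide) (by decide) (by decide)
  have hrcv n : f^[n] τ .rcv = τ .rcv := other n .rcv (by decide) (by decide) (by decide)
  refine ⟨Set.Subset.antisymm ?_ ?_, other L⟩
  · have sound : ∀ n, (∀ a, (a, a, a) ∈ f^[n] τ .sendable →
          ∃ p q, (netOf τ).Reachable p ∧ (p, a, q) ∈ τ .snd) ∧
        (∀ q, (q, q, q) ∈ f^[n] τ .aux → (netOf τ).Reachable q) ∧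
        ∀ q, (q, q, q) ∈ f^[n] τ .ini → (netOf τ).Reachable q := by
      intro n
      induction n with
      | zero =>
        refine ⟨fun a ha => ?_, fun q hq => ?_, fun q hq => .init hq⟩
        · simp [h1] at ha
        · simp [h2] at hq
      | succ n ih =>
        obtain ⟨ih1, ih2, ih3⟩ := ih
        obtain ⟨g1, g2, g3, -⟩ := h (f^[n] τ)
        rw [← iterate_succ_apply' f, hsnd] at g1
        rw [← iterate_succ_apply' f, hsnd, hrcv] at g2
        rw [← iterate_succ_apply' f] at g3
        have k1 : ∀ a, (a, a, a) ∈ f^[n + 1] τ .sendable →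
            ∃ p q, (netOf τ).Reachable p ∧ (p, a, q) ∈ τ .snd := by
          intro a ha
          rcases (g1 a).1 ha with ha | ⟨p, q, hpq, hp⟩
          · exact ih1 a ha
          · exact ⟨p, q, ih3 p hp, hpq⟩
        have k2 : ∀ q, (q, q, q) ∈ f^[n + 1] τ .aux → (netOf τ).Reachable q := by
          intro q hq
          rcases (g2 q).1 hq with (hq | ⟨p, a, hpq, hp⟩) | ⟨p, a, ⟨hpq, hp⟩, ha⟩
          · exact ih2 q hq
          · exact .send (a := a) (ih3 p hp) hpq
          · obtain ⟨p', q', hp', hpq'⟩ := k1 a ha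
            exact .recv (a := a) (ih3 p hp) hpq hp' hpq'
        exact ⟨k1, k2, fun q hq => ((g3 q).1 hq).elim (ih3 q) (k2 q)⟩
    exact fun q hq => (sound L).2.2 q hq
  · have mono n : un (f^[n] τ) .ini ⊆ un (f^[n + 1] τ) .ini := by
      intro q hq
      rw [iterate_succ_apply']
      exact ((h _).2.2.1 q).2 (.inl hq)
    refine subset_of_chain (S := fun n => un (f^[n] τ) .ini) mono (fun n hn q hq => ?_) (by simp)
    obtain ⟨g1, g2, g3, -⟩ := h (f^[n] τ)
    rw [← iterate_succ_apply' f, hsnd] at g1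
    rw [← iterate_succ_apply' f, hsnd, hrcv] at g2
    rw [← iterate_succ_apply' f] at g3
    induction hq with
    | init hq => exact monotone_nat_of_le_succ mono (Nat.zero_le n) hq
    | send _ hpq ih => exact hn ((g3 _).2 (.inr ((g2 _).2 (.inl (.inr ⟨_, _, hpq, ih⟩)))))
    | recv _ hpq _ hpq' ih ih' =>
      exact hn ((g3 _).2 (.inr ((g2 _).2 (.inr ⟨_, _, ⟨hpq, ih⟩,
        (g1 _).2 (.inr ⟨_, _, hpq', ih'⟩)⟩))))

/-! ### Pruning the transitions. -/

/-- Remove the transitions whose sources are not initial. -/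
def restrict : Prog :=
  .seq (rule (.ini, .p, .p, .p) (.ini, .p, .p, .p) (.ini, .p, .p, .p) (fun a _ _ => !a)
      (.snd, .p, .a, .q) false)
    (rule (.ini, .p, .p, .p) (.ini, .p, .p, .p) (.ini, .p, .p, .p) (fun a _ _ => !a)
      (.rcv, .p, .a, .q) false)

theorem exists_computes_restrict : ∃ f : Tables L → Tables L, Computes L restrict f ∧
    ∀ τ, (∀ p o q, (p, o, q) ∈ trans (f τ) ↔ (p, o, q) ∈ trans τ ∧ p ∈ un τ .ini) ∧
      ∀ t, t ≠ .snd → t ≠ .rcv → f τ t = τ t := by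
  refine ⟨_, (computes_rule (by decide) (by decide) (by decide)).seq
    (computes_rule (by decide) (by decide) (by decide)), fun τ => ⟨?_, ?_⟩⟩
  · rintro p (a | a) q <;> simp [ruleMap, amend, val, valuation, un]
  · intro t h1 h2
    simp [ruleMap, h1, h2]

def clear (t : Tab) : Prog :=
  rule (.inp, .x, .x, .x) (.inp, .x, .x, .x) (.inp, .x, .x, .x) (fun _ _ _ => true)
    (t, .x, .p, .a) false

theorem computes_clear {t : Tab} (ht : .inp ≠ t) :
    Computes L (clear t) (fun τ => update τ t ∅) := by
  have := computes_rule (L := L) (r₁ := (.inp, .x, .x, .x)) (r₂ := (.inp, .x, .x, .x))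
    (r₃ := (.inp, .x, .x, .x)) (w := (t, .x, .p, .a)) (g := fun _ _ _ => true) (b := false)
    ht ht ht
  convert this using 1
  · rfl
  funext τ
  simp only [ruleMap]
  congr 1
  ext ⟨i, j, k⟩
  simp [amend, val, valuation]

/-- Initialize the tables for an iteration of the pruning. -/
def pruneInit : Prog :=
  .seq (clear .aux) (.seq (clear .ok) (.seq (clear .sendable) (.seq (clear .walk)
    (rule (.inp, .x, .x, .x) (.inp, .x, .x, .x) (.inp, .x, .x, .x) (fun _ _ _ => true)
      (.walk, .x, .x, .x) true))))

theorem exists_computes_pruneInit : ∃ f : Tables L → Tables L, Computes L pruneInit f ∧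
    ∀ τ, f τ .aux = ∅ ∧ f τ .ok = ∅ ∧ f τ .sendable = ∅ ∧
      (∀ p q, (p, q, q) ∈ f τ .walk ↔ p = q) ∧
      ∀ t, t ≠ .aux → t ≠ .ok → t ≠ .sendable → t ≠ .walk → f τ t = τ t := by
  refine ⟨_, (computes_clear (by decide)).seq ((computes_clear (by decide)).seq
    ((computes_clear (by decide)).seq ((computes_clear (by decide)).seq
    (computes_rule (by decide) (by decide) (by decide))))), fun τ => ⟨?_, ?_, ?_, ?_, ?_⟩⟩
  · simp [ruleMap]
  · simp [ruleMap]
  · simp [ruleMap]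
  · intro p q
    simp [ruleMap, amend, val, valuation, eq_comm]
  · intro t h1 h2 h3 h4
    simp [ruleMap, h1, h2, h3, h4]

/-- Extend the walks by a transition. -/
def walkStep : Prog :=
  .seq (rule (.walk, .x, .p, .p) (.snd, .p, .a, .q) (.snd, .p, .a, .q) both
      (.aux, .x, .q, .q) true)
    (.seq (rule (.walk, .x, .p, .p) (.rcv, .p, .a, .q) (.rcv, .p, .a, .q) both
      (.aux, .x, .q, .q) true)
    (rule (.aux, .x, .q, .q) (.aux, .x, .q, .q) (.aux, .x, .q, .q) both (.walk, .x, .q, .q) true))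

theorem exists_computes_walkStep : ∃ f : Tables L → Tables L, Computes L walkStep f ∧
    ∀ τ, (∀ x q, (x, q, q) ∈ f τ .aux ↔ (x, q, q) ∈ τ .aux ∨
        ∃ p, (x, p, p) ∈ τ .walk ∧ Edge (trans τ) p q) ∧
      (∀ x q, (x, q, q) ∈ f τ .walk ↔ (x, q, q) ∈ τ .walk ∨ (x, q, q) ∈ f τ .aux) ∧
      ∀ t, t ≠ .aux → t ≠ .walk → f τ t = τ t := by
  refine ⟨_, (computes_rule (by decide) (by decide) (by decide)).seq
    ((computes_rule (by decide) (by decide) (by decide)).seq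
    (computes_rule (by decide) (by decide) (by decide))), fun τ => ⟨?_, ?_, ?_⟩⟩
  · intro x q
    have : ∀ p, Edge (trans τ) p q ↔ (∃ a, (p, a, q) ∈ τ .snd) ∨ ∃ a, (p, a, q) ∈ τ .rcv := by
      intro p
      constructor
      · rintro ⟨a | a, h⟩
        · exact .inl ⟨a, h⟩
        · exact .inr ⟨a, h⟩
      · rintro (⟨a, h⟩ | ⟨a, h⟩)
        · exact ⟨.send a, h⟩
        · exact ⟨.recv a, h⟩
    simp [ruleMap, amend, both, val, valuation, this, and_or_left, exists_or, or_assoc]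
  · intro x q
    simp [ruleMap, amend, both, val, valuation]
  · intro t h1 h2
    simp [ruleMap, h1, h2]

open Relation

/-- The chain lives in the pairs of states, so two nested loops, that is `L * L` rounds, reach the
reflexive transitive closure. -/
theorem exists_computes_walks : ∃ f : Tables L → Tables L,
    Computes L (.loop (.loop walkStep)) f ∧
    ∀ τ, τ .aux = ∅ → (∀ p q, (p, q, q) ∈ τ .walk ↔ p = q) →
      (∀ p q, (p, q, q) ∈ f τ .walk ↔ ReflTransGen (Edge (trans τ)) p q) ∧
      ∀ t, t ≠ .aux → t ≠ .walk → f τ t = τ t := by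
  obtain ⟨f, hf, h⟩ := exists_computes_walkStep (L := L)
  refine ⟨_, hf.loop.loop, fun τ h1 h2 => ?_⟩
  rw [← iterate_mul]
  have other : ∀ n t, t ≠ .aux → t ≠ .walk → f^[n] τ t = τ t := by
    intro n t h3 h4
    induction n with
    | zero => rfl
    | succ n ih => rw [iterate_succ_apply', (h _).2.2 t h3 h4, ih]
  have htrans n : trans (f^[n] τ) = trans τ := by
    ext ⟨p, a | a, q⟩
    · rw [send_mem_trans, other _ _ (by decide) (by decide), send_mem_trans]
    · rw [recv_mem_trans, other _ _ (by decide) (by decide), recv_mem_trans]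
  refine ⟨fun p q => ⟨?_, fun hpq => ?_⟩, other _⟩
  · have sound : ∀ n, (∀ p q, (p, q, q) ∈ f^[n] τ .aux → ReflTransGen (Edge (trans τ)) p q) ∧
        ∀ p q, (p, q, q) ∈ f^[n] τ .walk → ReflTransGen (Edge (trans τ)) p q := by
      intro n
      induction n with
      | zero =>
        refine ⟨fun p q hq => ?_, fun p q hq => ?_⟩
        · simp [h1] at hq
        · rw [(h2 p q).1 hq]
      | succ n ih =>
        obtain ⟨g1, g2, -⟩ := h (f^[n] τ)
        rw [← iterate_succ_apply' f, htrans] at g1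
        rw [← iterate_succ_apply' f] at g2
        have k : ∀ p q, (p, q, q) ∈ f^[n + 1] τ .aux → ReflTransGen (Edge (trans τ)) p q := by
          intro p q hpq
          rcases (g1 p q).1 hpq with hpq | ⟨r, hpr, hrq⟩
          · exact ih.1 p q hpq
          · exact (ih.2 p r hpr).tail hrq
        exact ⟨k, fun p q hpq => ((g2 p q).1 hpq).elim (ih.2 p q) (k p q)⟩
    exact (sound _).2 p q
  · let S : ℕ → Set (Fin L × Fin L) := fun n => {i | (i.1, i.2, i.2) ∈ f^[n] τ .walk}
    have mono n : S n ⊆ S (n + 1) := by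
      intro i hi
      simp only [S, iterate_succ_apply', Set.mem_ofPred_eq]
      exact ((h _).2.1 _ _).2 (.inl hi)
    have := subset_of_chain (C := {i | ReflTransGen (Edge (trans τ)) i.1 i.2}) mono
      (fun n hn => ?_) (N := L * L) (by simp)
    · exact this (a := (p, q)) hpq
    · rintro ⟨p, q⟩ hpq
      obtain ⟨g1, g2, -⟩ := h (f^[n] τ)
      rw [← iterate_succ_apply' f, htrans] at g1
      rw [← iterate_succ_apply' f] at g2
      simp only [Set.mem_ofPred_eq] at hpq
      induction hpq with
      | refl =>
        exact (monotone_nat_of_le_succ mono (Nat.zero_le n) : S 0 ⊆ S n) (a := (p, p))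
          ((h2 p p).2 rfl)
      | tail _ hrq ih =>
        exact hn (a := (_, _)) ((g2 _ _).2 (.inr ((g1 _ _).2 (.inr ⟨_, ih, hrq⟩))))

/-- Remove the transitions without a closed walk through a final state and the receives without
a send. -/
def prune : Prog :=
  .seq pruneInit (.seq (.loop (.loop walkStep))
    (.seq (rule (.fin, .x, .x, .x) (.walk, .q, .x, .x) (.walk, .x, .p, .p) all
      (.ok, .q, .p, .p) true)
    (.seq (rule (.snd, .p, .a, .q) (.snd, .p, .a, .q) (.snd, .p, .a, .q) both
      (.sendable, .a, .a, .a) true)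
    (.seq (rule (.ok, .q, .p, .p) (.ok, .q, .p, .p) (.ok, .q, .p, .p) (fun a _ _ => !a)
      (.snd, .p, .a, .q) false)
    (rule (.ok, .q, .p, .p) (.sendable, .a, .a, .a) (.sendable, .a, .a, .a)
      (fun a b _ => !(a && b)) (.rcv, .p, .a, .q) false)))))

/-- The tables `ok` and `sendable` are filled before any transition is removed, so both conditions
refer to the transitions at the beginning of the round. -/
theorem exists_computes_prune : ∃ f : Tables L → Tables L, Computes L prune f ∧
    ∀ τ, f τ .fin = τ .fin ∧ f τ .ini = τ .ini ∧ f τ .res = τ .res ∧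
      ∀ p o q, (p, o, q) ∈ trans (f τ) ↔ (p, o, q) ∈ trans τ ∧
        (∃ x ∈ un τ .fin, ReflTransGen (Edge (trans τ)) q x ∧ ReflTransGen (Edge (trans τ)) x p) ∧
        ∀ a, o = .recv a → ∃ p' q', (p', Op.send a, q') ∈ trans τ := by
  obtain ⟨f, hf, h⟩ := exists_computes_pruneInit (L := L)
  obtain ⟨g, hg, h'⟩ := exists_computes_walks (L := L)
  refine ⟨_, hf.seq (hg.seq ((computes_rule (by decide) (by decide) (by decide)).seq
    ((computes_rule (by decide) (by decide) (by decide)).seq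
    ((computes_rule (by decide) (by decide) (by decide)).seq
    (computes_rule (by decide) (by decide) (by decide)))))), fun τ => ?_⟩
  obtain ⟨h1, h2, h3, h4, h5⟩ := h τ
  obtain ⟨h6, h7⟩ := h' (f τ) h1 h4
  have other t (k1 : t ≠ .aux) (k2 : t ≠ .ok) (k3 : t ≠ .sendable) (k4 : t ≠ .walk) :
      g (f τ) t = τ t := by
    rw [h7 t k1 k4, h5 t k1 k2 k3 k4]
  have htrans : trans (f τ) = trans τ := by
    ext ⟨p, a | a, q⟩ <;> simp [h5]
  rw [htrans] at h6
  have hok : g (f τ) .ok = ∅ := by rw [h7 _ (by decide) (by decide), h2]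
  have hsendable : g (f τ) .sendable = ∅ := by rw [h7 _ (by decide) (by decide), h3]
  refine ⟨?_, ?_, ?_, ?_⟩
  · simp [ruleMap, other]
  · simp [ruleMap, other]
  · simp [ruleMap, other]
  · rintro p (a | a) q
    · simp [ruleMap, other, amend, all, both, val, valuation, un, h6, hok, hsendable, and_assoc]
    · simp [ruleMap, other, amend, all, both, val, valuation, un, h6, hok, hsendable, and_assoc]

theorem card_op_le (D : Type) [Finite D] : Nat.card (Op D) ≤ 2 * Nat.card D := by
  have : Function.Injective fun o : Op D => match o with
      | .send a => (Sum.inl a : D ⊕ D)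
      | .recv a => .inr a := by
    rintro (a | a) (b | b) h <;> simp_all
  have := Nat.card_le_card_of_injective _ this
  rwa [Nat.card_sum, ← two_mul] at this

/-- A set with both closure properties survives every round, since its walks and sends are still
there. Conversely, at a stall the remaining transitions themselves have these properties. -/
theorem exists_computes_prunes : ∃ f : Tables L → Tables L,
    Computes L (.loop (.loop (.loop (.loop prune)))) f ∧
    ∀ τ, 2 ≤ L → f τ .res = τ .res ∧ ((trans (f τ)).Nonempty ↔
      ∃ T ⊆ trans τ, T.Nonempty ∧
        (∀ p a q, (p, Op.recv a, q) ∈ T → ∃ p' q', (p', Op.send a, q') ∈ T) ∧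
        ∀ p o q, (p, o, q) ∈ T →
          ∃ x ∈ un τ .fin, ReflTransGen (Edge T) q x ∧ ReflTransGen (Edge T) x p) := by
  obtain ⟨f, hf, h⟩ := exists_computes_prune (L := L)
  refine ⟨_, hf.loop.loop.loop.loop, fun τ hL => ?_⟩
  rw [← iterate_mul, ← iterate_mul, ← iterate_mul]
  have hfin : ∀ n, f^[n] τ .fin = τ .fin ∧ f^[n] τ .res = τ .res := by
    intro n
    induction n with
    | zero => exact ⟨rfl, rfl⟩
    | succ n ih =>
      rw [iterate_succ_apply', (h _).1, (h _).2.2.1]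
      exact ih
  have hun n : un (f^[n] τ) .fin = un τ .fin := by simp [un, hfin]
  have step n p o q := (h (f^[n] τ)).2.2.2 p o q
  simp only [← iterate_succ_apply' f, hun] at step
  have anti n : trans (f^[n + 1] τ) ⊆ trans (f^[n] τ) := fun ⟨p, o, q⟩ hi => ((step n p o q).1 hi).1
  refine ⟨(hfin _).2, fun hne => ?_, ?_⟩
  · obtain ⟨i, hi⟩ := hne
    -- The deleted transitions form the increasing chain. The set `C` is everything if no suitable
    -- `T` exists and empty otherwise, so without a suitable `T` nothing would remain.
    have := subset_of_chain (S := fun n => (trans (f^[n] τ))ᶜ)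
      (fun n => Set.compl_subset_compl.2 (anti n)) (C := {i | ¬∃ T ⊆ trans τ, T.Nonempty ∧
        (∀ p a q, (p, Op.recv a, q) ∈ T → ∃ p' q', (p', Op.send a, q') ∈ T) ∧
        ∀ p o q, (p, o, q) ∈ T →
          ∃ x ∈ un τ .fin, ReflTransGen (Edge T) q x ∧ ReflTransGen (Edge T) x p})
      (fun n hn i hi hi' => hi ⟨trans (f^[n] τ),
        antitone_nat_of_succ_le (f := fun n => trans (f^[n] τ)) anti (Nat.zero_le n),
        ⟨i, hi'⟩, fun p a q hpq => ?_, fun p o q hpq => ?_⟩) (N := L * (L * (L * L))) ?_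
    · by_contra hc
      exact this hc hi
    · exact ((step n _ _ _).1 (Set.compl_subset_compl.1 hn hpq)).2.2 a rfl
    · exact ((step n _ _ _).1 (Set.compl_subset_compl.1 hn hpq)).2.1
    -- There are `2 * L ^ 3` conceivable transitions, which is at most the number `L ^ 4` of rounds
    -- because `2 ≤ L`.
    · rw [Nat.card_prod, Nat.card_prod]
      have h1 := card_op_le (Fin L)
      simp only [Nat.card_eq_fintype_card, Fintype.card_fin] at h1 ⊢
      calc L * (Nat.card (Op (Fin L)) * L) ≤ L * ((2 * L) * L) := by gcongr
        _ ≤ L * ((L * L) * L) := by gcongr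
        _ = L * (L * (L * L)) := by ring
  · rintro ⟨T, hT, hne, h1, h2⟩
    have key : ∀ n, T ⊆ trans (f^[n] τ) := by
      intro n
      induction n with
      | zero => exact hT
      | succ n ih =>
        rintro ⟨p, o, q⟩ hi
        have lift {x y} (hxy : ReflTransGen (Edge T) x y) :
            ReflTransGen (Edge (trans (f^[n] τ))) x y :=
          ReflTransGen.mono (fun _ _ ⟨o, ho⟩ => ⟨o, ih ho⟩) _ _ hxy
        obtain ⟨x, hx, h3, h4⟩ := h2 p o q hi
        refine (step n p o q).2 ⟨ih hi, ⟨x, hx, lift h3, lift h4⟩, ?_⟩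
        rintro a rfl
        obtain ⟨p', q', h5⟩ := h1 p a q hi
        exact ⟨p', q', ih h5⟩
    exact hne.mono (key _)

/-! ### The search on a stored network. -/

/-- Decide if the network that is stored in the tables has a fair computation. -/
def search : Prog :=
  .seq (.seq (.loop reachStep) (.seq restrict (.seq (.loop (.loop (.loop (.loop prune))))
    (rule (.snd, .p, .a, .q) (.rcv, .p, .a, .q) (.rcv, .p, .a, .q) (fun a b _ => a || b)
      (.res, .zero, .zero, .zero) true))))
    (.read .res .zero .zero .zero fun v b => { v with b₁ := b })

/-- Restriction to reachable sources supplies the part of sustainability that pruning ignores, so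
the surviving transitions are nonempty exactly if a nonempty sustainable set exists. -/
theorem run_search {τ : Tables L} (hL : 2 ≤ L) (h1 : τ .sendable = ∅) (h2 : τ .aux = ∅)
    (h3 : τ .res = ∅) :
    (run search ⟨Reg.idle, fun _ => 0, τ⟩).reg.b₁ = true ↔
      (netOf τ).HasFairComputation (un τ .fin) := by
  obtain ⟨f₁, c₁, r₁⟩ := exists_computes_reach (L := L)
  obtain ⟨f₂, c₂, r₂⟩ := exists_computes_restrict (L := L)
  obtain ⟨f₃, c₃, r₃⟩ := exists_computes_prunes (L := L)
  have c := c₁.seq (c₂.seq (c₃.seq (computes_rule (r₁ := (.snd, .p, .a, .q))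
    (r₂ := (.rcv, .p, .a, .q)) (r₃ := (.rcv, .p, .a, .q)) (g := fun a b _ => a || b)
    (w := (.res, .zero, .zero, .zero)) (b := true) (by decide) (by decide) (by decide)))) τ
  obtain ⟨hini, h4⟩ := r₁ τ h1 h2
  obtain ⟨htrans, h5⟩ := r₂ (f₁ τ)
  obtain ⟨hres, h6⟩ := r₃ (f₂ (f₁ τ)) hL
  have hfin : un (f₂ (f₁ τ)) .fin = un τ .fin := by simp [un, h5, h4]
  have htrans' : trans (f₁ τ) = trans τ := by
    ext ⟨p, a | a, q⟩ <;> simp [h4]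
  rw [htrans', hini] at htrans
  rw [hfin] at h6
  have hres : f₃ (f₂ (f₁ τ)) .res = ∅ := by rw [hres, h5, h4, h3] <;> decide
  have h7 : (trans (f₃ (f₂ (f₁ τ)))).Nonempty ↔ ∃ p a q,
      (p, a, q) ∈ f₃ (f₂ (f₁ τ)) .snd ∨ (p, a, q) ∈ f₃ (f₂ (f₁ τ)) .rcv := by
    constructor
    · rintro ⟨⟨p, a | a, q⟩, h⟩
      · exact ⟨p, a, q, .inl h⟩
      · exact ⟨p, a, q, .inr h⟩
    · rintro ⟨p, a, q, h | h⟩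
      · exact ⟨(p, .send a, q), h⟩
      · exact ⟨(p, .recv a, q), h⟩
  rw [hasFairComputation_iff]
  trans (trans (f₃ (f₂ (f₁ τ)))).Nonempty
  · rw [h7]
    simp only [search, run] at c ⊢
    rw [c]
    simp [ruleMap, hres, amend, val, valuation]
  · rw [h6]
    constructor
    · rintro ⟨T, hT, hne, h8, h9⟩
      exact ⟨T, hne, fun ⟨p, o, q⟩ hi => ((htrans p o q).1 (hT hi)).1,
        fun hi => ((htrans _ _ _).1 (hT hi)).2, fun hi => h8 _ _ _ hi, fun hi => h9 _ _ _ hi⟩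
    · rintro ⟨T, hne, hT⟩
      exact ⟨T, fun ⟨p, o, q⟩ hi => (htrans p o q).2 ⟨hT.subset hi, hT.reachable hi⟩, hne,
        fun _ _ _ hi => hT.exists_send hi, fun _ _ _ hi => hT.cycle hi⟩

end FairDecider

/-! ### The parser. -/

open Turing Function

namespace FairDecider

open TableProg BroadcastNet BroadcastNet.Instance

variable {L : ℕ} [NeZero L]

/-- The next phase of the parser. -/
def Phase.next : Phase → Bool → Phase
  | .states, b => bif b then .states else .msgs
  | .msgs, b => bif b then .msgs else .initHead
  | .initHead, b => bif b then .initNum else .finHead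
  | .initNum, b => bif b then .initNum else .initHead
  | .finHead, b => bif b then .finNum else .transHead
  | .finNum, b => bif b then .finNum else .finHead
  | .transHead, b => bif b then .source else .finished
  | .source, b => bif b then .source else .operation
  | .operation, b => .msg b
  | .msg c, b => bif b then .msg c else .target c
  | .target c, b => bif b then .target c else .transHead
  | .finished, _ => .finished

/-- The phase reads a number into variable `q`. -/
def Phase.readsState : Phase → Bool
  | .initNum => true
  | .finNum => true
  | .target _ => true
  | _ => false

/-- The phase reads a number into variable `a`. -/
def Phase.readsMsg : Phase → Bool
  | .msg _ => true
  | _ => false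

/-- If the current bit is `b` and the phase satisfies `c`, then execute `p`. -/
def onBit (b : Bool) (c : Phase → Bool) (p : Prog) : Prog :=
  .ite (fun v => v.b₁ == b && c v.phase) p (.assign id)

/-- Process the input bit at the current position. -/
def parseStep : Prog :=
  .seq (.read .inp .zero .zero .idx fun v b => { v with b₁ := b })
    (.seq (onBit true (fun | .source => true | _ => false) (.incr .p))
    (.seq (onBit true Phase.readsMsg (.incr .a))
    (.seq (onBit true Phase.readsState (.incr .q))
    (.seq (onBit false (fun | .initNum => true | _ => false) (.write .ini .q .q .q true))
    (.seq (onBit false (fun | .finNum => true | _ => false) (.write .fin .q .q .q true))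
    (.seq (onBit false (fun | .target true => true | _ => false) (.write .snd .p .a .q true))
    (.seq (onBit false (fun | .target false => true | _ => false) (.write .rcv .p .a .q true))
    (.seq (onBit false Phase.readsState (.seq (.reset .p) (.seq (.reset .a) (.reset .q))))
    (.seq (.assign fun v => ⟨v.phase.next v.b₁, false, false, false⟩)
    (.incr .idx))))))))))

/-- The states of the parser. -/
structure ParseState (L : ℕ) where
  phase : Phase
  p : Fin L
  a : Fin L
  q : Fin L
  tab : Tables L

/-- Add an element to a table. -/
def addTo (τ : Tables L) (t : Tab) (i : Fin L × Fin L × Fin L) : Tables L :=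
  update τ t (insert i (τ t))

/-- The effect of `parseStep` if the bit is `b`. -/
def ParseState.next (s : ParseState L) (b : Bool) : ParseState L :=
  match s.phase, b with
  | .source, true => { s with p := s.p + 1 }
  | .msg _, true => { s with a := s.a + 1 }
  | .initNum, true => { s with q := s.q + 1 }
  | .finNum, true => { s with q := s.q + 1 }
  | .target _, true => { s with q := s.q + 1 }
  | .initNum, false => ⟨.initHead, 0, 0, 0, addTo s.tab .ini (s.q, s.q, s.q)⟩
  | .finNum, false => ⟨.finHead, 0, 0, 0, addTo s.tab .fin (s.q, s.q, s.q)⟩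
  | .target true, false => ⟨.transHead, 0, 0, 0, addTo s.tab .snd (s.p, s.a, s.q)⟩
  | .target false, false => ⟨.transHead, 0, 0, 0, addTo s.tab .rcv (s.p, s.a, s.q)⟩
  | phase, b => { s with phase := phase.next b }

def parseVars (i p a q : Fin L) : Var → Fin L
  | .zero => 0
  | .idx => i
  | .x => 0
  | .p => p
  | .a => a
  | .q => q

section parseVars

variable (i p a q j : Fin L)

theorem update_parseVars_p : update (parseVars i p a q) .p j = parseVars i j a q := by
  funext v
  cases v <;> simp [parseVars]

theorem update_parseVars_a : update (parseVars i p a q) .a j = parseVars i p j q := by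
  funext v
  cases v <;> simp [parseVars]

theorem update_parseVars_q : update (parseVars i p a q) .q j = parseVars i p a j := by
  funext v
  cases v <;> simp [parseVars]

theorem update_parseVars_idx : update (parseVars i p a q) .idx j = parseVars j p a q := by
  funext v
  cases v <;> simp [parseVars]

end parseVars

/-- The state of the table program that represents a state of the parser at position `i`. -/
def ParseState.toTable (s : ParseState L) (i : Fin L) : TableState Tab Var Reg L :=
  ⟨⟨s.phase, false, false, false⟩, parseVars i s.p s.a s.q, s.tab⟩

section run

variable (s : TableState Tab Var Reg L)

theorem run_seq (p p' : Prog) : run (.seq p p') s = run p' (run p s) :=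
  rfl

theorem run_assign (f : Reg → Reg) : run (.assign f) s = { s with reg := f s.reg } :=
  rfl

theorem run_incr (u : Var) :
    run (.incr u) s = { s with var := update s.var u (s.var u + 1) } :=
  rfl

theorem run_reset (u : Var) : run (.reset u) s = { s with var := update s.var u 0 } :=
  rfl

theorem run_write_true (t : Tab) (u v w : Var) :
    run (.write t u v w true) s = { s with tab := addTo s.tab t (s.var u, s.var v, s.var w) } :=
  rfl

theorem run_onBit (b : Bool) (c : Phase → Bool) (p : Prog) :
    run (onBit b c p) s = bif s.reg.b₁ == b && c s.reg.phase then run p s else s :=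
  rfl

end run

/-- All tests see the old phase because it is changed only after them, and counters are reset only
after their values have been written to a table. The claim is then a check of all phases and both
bits. -/
theorem run_parseStep (s : ParseState L) (i : Fin L) :
    run parseStep (s.toTable i) = (s.next (bit ((0, 0, i) ∈ s.tab .inp))).toTable (i + 1) := by
  obtain ⟨phase, p, a, q, τ⟩ := s
  have h0 : run (.read .inp .zero .zero .idx fun v b => { v with b₁ := b })
      (ParseState.toTable ⟨phase, p, a, q, τ⟩ i) =
      ⟨⟨phase, bit ((0, 0, i) ∈ τ .inp), false, false⟩, parseVars i p a q, τ⟩ := rfl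
  rw [parseStep, run_seq, h0]
  generalize bit ((0, 0, i) ∈ τ .inp) = b
  have hp j p a q : parseVars (L := L) j p a q .p = p := rfl
  have ha j p a q : parseVars (L := L) j p a q .a = a := rfl
  have hq j p a q : parseVars (L := L) j p a q .q = q := rfl
  have hi j p a q : parseVars (L := L) j p a q .idx = j := rfl
  cases b <;> rcases phase with _ | _ | _ | _ | _ | _ | _ | _ | _ | (_ | _) | (_ | _) | _ <;>
    simp [run_seq, run_assign, run_incr, run_reset, run_write_true, run_onBit, ParseState.toTable,
      ParseState.next, Phase.next, Phase.readsState, Phase.readsMsg,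
      update_parseVars_p, update_parseVars_a, update_parseVars_q, update_parseVars_idx,
      hp, ha, hq, hi]

theorem ParseState.next_inp (s : ParseState L) (b : Bool) : (s.next b).tab .inp = s.tab .inp := by
  obtain ⟨phase, p, a, q, τ⟩ := s
  cases b <;> rcases phase with _ | _ | _ | _ | _ | _ | _ | _ | _ | (_ | _) | (_ | _) | _ <;>
    simp [ParseState.next, addTo]

/-- Parse the input. -/
def parse : Prog :=
  .seq (.loop parseStep) (.assign fun _ => Reg.idle)

theorem run_parse (w : List Bool) [NeZero w.length] {τ : Tables w.length} {phase : Phase}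
    (h : w.foldl ParseState.next
      ⟨.states, 0, 0, 0, (start (V := Var) .inp Reg.idle w).tab⟩ = ⟨phase, 0, 0, 0, τ⟩) :
    run parse (start .inp Reg.idle w) = ⟨Reg.idle, fun _ => 0, τ⟩ := by
  set s₀ : ParseState w.length :=
    ⟨.states, 0, 0, 0, (start (V := Var) .inp Reg.idle w).tab⟩ with hs₀
  -- That table `inp` is unchanged belongs to the invariant, as the later bits are read from it.
  have key : ∀ n ≤ w.length, (run parseStep)^[n] (start .inp Reg.idle w) =
      ((w.take n).foldl ParseState.next s₀).toTable (Fin.ofNat w.length n) ∧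
      ((w.take n).foldl ParseState.next s₀).tab .inp = s₀.tab .inp := by
    intro n
    induction n with
    | zero =>
      refine fun _ => ⟨?_, rfl⟩
      simp only [iterate_zero, id, List.take_zero, List.foldl_nil, ParseState.toTable, hs₀]
      simp only [start, TableState.mk.injEq, and_true]
      refine ⟨rfl, ?_⟩
      funext v
      cases v <;> simp [parseVars]
    | succ n ih =>
      intro hn
      obtain ⟨ih1, ih2⟩ := ih (by omega)
      have hw : w.take (n + 1) = w.take n ++ [w[n]] := by simp
      rw [hw, List.foldl_append, List.foldl_cons, List.foldl_nil, ParseState.next_inp, ih2,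
        iterate_succ_apply', ih1, run_parseStep, ih2]
      refine ⟨?_, rfl⟩
      have hb : bit ((0, 0, Fin.ofNat w.length n) ∈ s₀.tab .inp) = w[n] := by
        have hmod : n % w.length = n := Nat.mod_eq_of_lt (by omega)
        rw [Bool.eq_iff_iff, bit_eq_true]
        simp [hs₀, start, hmod]
      rw [hb]
      congr 1
      apply Fin.ext
      simp only [Fin.val_add, Fin.val_ofNat, Fin.val_one', Nat.add_mod_mod, Nat.mod_add_mod]
  have h1 := (key w.length le_rfl).1
  rw [List.take_length, h] at h1
  -- After `w.length` increments the position `idx` has wrapped around to zero, so the search starts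
  -- with all variables zero.
  simp only [parse, run, h1, ParseState.toTable, TableState.mk.injEq, true_and, and_true]
  funext v
  cases v <;> simp [parseVars]

/-- Here `f` is the parser state as a function of the counter that the current phase advances. For a
number that is skipped, `f` is constant. -/
theorem foldl_encodeNum {f : Fin L → ParseState L} (hf : ∀ i, (f i).next true = f (i + 1))
    (n : ℕ) (i : Fin L) :
    (encodeNum n).foldl ParseState.next (f i) = (f (i + Fin.ofNat L n)).next false := by
  induction n generalizing i with
  | zero =>
    have : i + Fin.ofNat L 0 = i := by
      apply Fin.ext
      simp
    simp [encodeNum]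
  | succ n ih =>
    have h1 : encodeNum (n + 1) = true :: encodeNum n := by
      simp [encodeNum, List.replicate_succ]
    rw [h1, List.foldl_cons, hf, ih]
    congr 2
    apply Fin.ext
    simp only [Fin.val_add, Fin.val_ofNat, Fin.val_one', Nat.add_mod_mod, Nat.mod_add_mod]
    congr 1
    omega

theorem foldl_encodeNum_zero {f : Fin L → ParseState L} (hf : ∀ i, (f i).next true = f (i + 1))
    (n : ℕ) : (encodeNum n).foldl ParseState.next (f 0) = (f (Fin.ofNat L n)).next false := by
  rw [foldl_encodeNum hf, zero_add]

theorem foldl_encodeItems {α : Type*} {e : α → List Bool} {head num done : Phase}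
    {add : Tables L → α → Tables L}
    (h1 : ∀ τ, ParseState.next (L := L) ⟨head, 0, 0, 0, τ⟩ true = ⟨num, 0, 0, 0, τ⟩)
    (h2 : ∀ τ x, (e x).foldl (ParseState.next (L := L)) ⟨num, 0, 0, 0, τ⟩ = ⟨head, 0, 0, 0, add τ x⟩)
    (h3 : ∀ τ, ParseState.next (L := L) ⟨head, 0, 0, 0, τ⟩ false = ⟨done, 0, 0, 0, τ⟩)
    (l : List α) (τ : Tables L) :
    (encodeItems e l).foldl ParseState.next ⟨head, 0, 0, 0, τ⟩ =
      ⟨done, 0, 0, 0, l.foldl add τ⟩ := by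
  induction l generalizing τ with
  | nil => simp [encodeItems, h3]
  | cons x l ih =>
    have : encodeItems e (x :: l) = true :: (e x ++ encodeItems e l) := by simp [encodeItems]
    rw [this, List.foldl_cons, List.foldl_append, h1, h2, ih, List.foldl_cons]

/-- The number of a state or message as a value of a variable. -/
def code (L : ℕ) [NeZero L] {n : ℕ} (q : Fin n) : Fin L :=
  Fin.ofNat L q

/-- Store a transition. -/
def addTrans {n d : ℕ} (τ : Tables L) (i : Fin n × Op (Fin d) × Fin n) : Tables L :=
  match i.2.1 with
  | .send a => addTo τ .snd (code L i.1, code L a, code L i.2.2)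
  | .recv a => addTo τ .rcv (code L i.1, code L a, code L i.2.2)

theorem foldl_encodeTrans {n d : ℕ} (τ : Tables L) (i : Fin n × Op (Fin d) × Fin n) :
    (encodeTrans i).foldl ParseState.next ⟨.source, 0, 0, 0, τ⟩ =
      ⟨.transHead, 0, 0, 0, addTrans τ i⟩ := by
  obtain ⟨p, a | a, q⟩ := i
  · simp only [encodeTrans, encodeOp, encodeFin, List.foldl_append, List.foldl_cons]
    rw [foldl_encodeNum_zero (f := fun i => ⟨.source, i, 0, 0, τ⟩) (fun _ => rfl)]
    simp only [ParseState.next, Phase.next, cond_false]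
    rw [foldl_encodeNum_zero (f := fun i => ⟨.msg true, _, i, 0, τ⟩) (fun _ => rfl)]
    simp only [ParseState.next, Phase.next, cond_false]
    rw [foldl_encodeNum_zero (f := fun i => ⟨.target true, _, _, i, τ⟩) (fun _ => rfl)]
    rfl
  · simp only [encodeTrans, encodeOp, encodeFin, List.foldl_append, List.foldl_cons]
    rw [foldl_encodeNum_zero (f := fun i => ⟨.source, i, 0, 0, τ⟩) (fun _ => rfl)]
    simp only [ParseState.next, Phase.next, cond_false]
    rw [foldl_encodeNum_zero (f := fun i => ⟨.msg false, _, i, 0, τ⟩) (fun _ => rfl)]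
    simp only [ParseState.next, Phase.next, cond_false]
    rw [foldl_encodeNum_zero (f := fun i => ⟨.target false, _, _, i, τ⟩) (fun _ => rfl)]
    rfl

/-- The tables after parsing. -/
def load (L : ℕ) [NeZero L] (x : Instance) (τ : Tables L) : Tables L :=
  x.transitions.foldl addTrans
    (x.final.foldl (fun τ q => addTo τ .fin (code L q, code L q, code L q))
      (x.initial.foldl (fun τ q => addTo τ .ini (code L q, code L q, code L q)) τ))

theorem foldl_encode (x : Instance) (τ : Tables L) :
    (encode x).foldl ParseState.next ⟨.states, 0, 0, 0, τ⟩ = ⟨.finished, 0, 0, 0, load L x τ⟩ := by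
  simp only [encode, List.foldl_append]
  -- The numbers of states and messages are skipped: the search works with all of `Fin L`, where
  -- superfluous values occur in no initial state and no transition.
  rw [foldl_encodeNum_zero (f := fun _ => ⟨.states, 0, 0, 0, τ⟩) (fun _ => rfl)]
  have h1 : ParseState.next (⟨.states, 0, 0, 0, τ⟩ : ParseState L) false = ⟨.msgs, 0, 0, 0, τ⟩ :=
    rfl
  rw [h1, foldl_encodeNum_zero (f := fun _ => ⟨.msgs, 0, 0, 0, τ⟩) (fun _ => rfl)]
  have h2 : ParseState.next (⟨.msgs, 0, 0, 0, τ⟩ : ParseState L) false =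
    ⟨.initHead, 0, 0, 0, τ⟩ := rfl
  rw [h2, foldl_encodeItems (num := .initNum) (done := .finHead)
    (add := fun τ q => addTo τ .ini (code L q, code L q, code L q)) (fun _ => rfl) ?_
    (fun _ => rfl), foldl_encodeItems (num := .finNum) (done := .transHead)
    (add := fun τ q => addTo τ .fin (code L q, code L q, code L q)) (fun _ => rfl) ?_
    (fun _ => rfl), foldl_encodeItems (num := .source) (done := .finished)
    (add := addTrans) (fun _ => rfl) foldl_encodeTrans (fun _ => rfl)]
  · rfl
  · intro τ q
    rw [encodeFin, foldl_encodeNum_zero (f := fun i => ⟨.finNum, 0, 0, i, τ⟩) (fun _ => rfl)]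
    rfl
  · intro τ q
    rw [encodeFin, foldl_encodeNum_zero (f := fun i => ⟨.initNum, 0, 0, i, τ⟩) (fun _ => rfl)]
    rfl

omit [NeZero L] in
theorem mem_foldl_addTo {α : Type*} {g : α → Fin L × Fin L × Fin L} (t t' : Tab) (l : List α)
    (τ : Tables L) (i : Fin L × Fin L × Fin L) :
    i ∈ l.foldl (fun τ x => addTo τ t (g x)) τ t' ↔ i ∈ τ t' ∨ t' = t ∧ ∃ x ∈ l, i = g x := by
  induction l generalizing τ with
  | nil => simp
  | cons x l ih =>
    rw [List.foldl_cons, ih]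
    by_cases h : t' = t
    · subst h
      simp [addTo, or_assoc, or_left_comm]
    · simp [addTo, h]

theorem mem_foldl_addTrans {n d : ℕ} (t : Tab) (l : List (Fin n × Op (Fin d) × Fin n))
    (τ : Tables L) (i : Fin L × Fin L × Fin L) :
    i ∈ l.foldl addTrans τ t ↔ i ∈ τ t ∨
      t = .snd ∧ (∃ p a q, (p, Op.send a, q) ∈ l ∧ i = (code L p, code L a, code L q)) ∨
      t = .rcv ∧ ∃ p a q, (p, Op.recv a, q) ∈ l ∧ i = (code L p, code L a, code L q) := by
  induction l generalizing τ with
  | nil => simp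
  | cons x l ih =>
    rw [List.foldl_cons, ih]
    obtain ⟨p, a | a, q⟩ := x
    · by_cases h : t = .snd
      · subst h
        simp [addTrans, addTo, or_and_right, exists_or, or_assoc, or_left_comm]
      · simp [addTrans, addTo, h]
    · by_cases h : t = .rcv
      · subst h
        simp [addTrans, addTo, or_and_right, exists_or, or_assoc, or_left_comm]
      · simp [addTrans, addTo, h]

/-! ### From stored networks to instances, and the main theorem. -/

theorem code_injective {n : ℕ} (h : n ≤ L) : Injective (code L : Fin n → Fin L) := by
  intro a b hab
  have := congrArg Fin.val hab
  simp only [code, Fin.val_ofNat] at this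
  rw [Nat.mod_eq_of_lt (a.isLt.trans_le h), Nat.mod_eq_of_lt (b.isLt.trans_le h)] at this
  exact Fin.ext this

/-- The coding of states and messages is a homomorphism into the stored network. As it is injective,
a left inverse is a homomorphism back on everything that is stored. -/
theorem hasFairComputation_load {x : Instance} {τ : Tables L} (hn : x.numStates ≤ L)
    (hd : x.numMsgs ≤ L) (hτ : ∀ t, t ≠ .inp → τ t = ∅) :
    (netOf (load L x τ)).HasFairComputation (un (load L x τ) .fin) ↔ FairLive x := by
  have hini q : q ∈ (netOf (load L x τ)).init ↔ ∃ p ∈ x.initial, q = code L p := by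
    simp [netOf, un, load, mem_foldl_addTrans, mem_foldl_addTo, hτ]
  have hfin q : q ∈ un (load L x τ) .fin ↔ ∃ p ∈ x.final, q = code L p := by
    simp [un, load, mem_foldl_addTrans, mem_foldl_addTo, hτ]
  have hsnd p a q : (p, Op.send a, q) ∈ (netOf (load L x τ)).trans ↔ ∃ p' a' q',
      (p', Op.send a', q') ∈ x.transitions ∧ p = code L p' ∧ a = code L a' ∧ q = code L q' := by
    simp [netOf, load, mem_foldl_addTrans, mem_foldl_addTo, hτ]
  have hrcv p a q : (p, Op.recv a, q) ∈ (netOf (load L x τ)).trans ↔ ∃ p' a' q',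
      (p', Op.recv a', q') ∈ x.transitions ∧ p = code L p' ∧ a = code L a' ∧ q = code L q' := by
    simp [netOf, load, mem_foldl_addTrans, mem_foldl_addTo, hτ]
  constructor
  · intro h
    -- `invFun` needs a state and a message of the instance; the first sender of the computation
    -- provides both.
    obtain ⟨k, π, h0, -⟩ := id h
    obtain ⟨p₀, -⟩ := (hini _).1 (h0 (π.sender 0))
    obtain ⟨-, a₀, -⟩ := (hsnd _ _ _).1 (π.step 0).2.1
    have : Nonempty (Fin x.numStates) := ⟨p₀⟩
    have : Nonempty (Fin x.numMsgs) := ⟨a₀⟩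
    have hi := leftInverse_invFun (code_injective hn)
    have hi' := leftInverse_invFun (code_injective hd)
    refine h.map (invFun (code L)) (invFun (code L)) ?_ ?_ ?_ ?_
    · intro q hq
      obtain ⟨p, hp, rfl⟩ := (hini q).1 hq
      rw [hi p]
      exact hp
    · intro q hq
      obtain ⟨p, hp, rfl⟩ := (hfin q).1 hq
      rw [hi p]
      exact hp
    · intro p a q h1
      obtain ⟨p', a', q', h2, rfl, rfl, rfl⟩ := (hsnd p a q).1 h1
      rw [hi p', hi q', hi' a']
      exact h2
    · intro p a q h1
      obtain ⟨p', a', q', h2, rfl, rfl, rfl⟩ := (hrcv p a q).1 h1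
      rw [hi p', hi q', hi' a']
      exact h2
  · intro h
    exact h.map (code L) (code L) (fun q hq => (hini _).2 ⟨q, hq, rfl⟩)
      (fun q hq => (hfin _).2 ⟨q, hq, rfl⟩)
      (fun p a q h1 => (hsnd _ _ _).2 ⟨p, a, q, h1, rfl, rfl, rfl⟩)
      (fun p a q h1 => (hrcv _ _ _).2 ⟨p, a, q, h1, rfl, rfl, rfl⟩)

theorem length_encode (x : Instance) :
    x.numStates + x.numMsgs + 2 ≤ (encode x).length := by
  simp only [encode, encodeNum, List.length_append, List.length_replicate, List.length_singleton]
  omega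

instance (x : Instance) : NeZero (encode x).length :=
  ⟨by have := length_encode x; omega⟩

/-- Decide if an instance is fairly live. -/
def decide : Prog :=
  .seq parse search

theorem run_decide (x : Instance) :
    (run decide (start .inp Reg.idle (encode x))).reg.b₁ = bit (FairLive x) := by
  have hx := length_encode x
  set τ := (start .inp Reg.idle (encode x) : TableState Tab Var Reg (encode x).length).tab with hτ
  have h0 : ∀ t, t ≠ .inp → τ t = ∅ := fun t ht => by simp [hτ, start, ht]
  have h1 := run_parse (encode x) (foldl_encode x _)
  rw [← hτ] at h1
  have other t (k1 : t ≠ .inp) (k2 : t ≠ .ini) (k3 : t ≠ .fin) (k4 : t ≠ .snd) (k5 : t ≠ .rcv) :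
      load (encode x).length x τ t = ∅ := by
    ext i
    simp [load, mem_foldl_addTrans, mem_foldl_addTo, h0, k1, k2, k3, k4, k5]
  rw [Bool.eq_iff_iff, bit_eq_true]
  simp only [decide, run, h1]
  rw [run_search (by omega) (by apply other <;> simp) (by apply other <;> simp)
    (by apply other <;> simp), hasFairComputation_load (by omega) (by omega) h0]

end FairDecider

theorem mainTheorem2 :
    BroadcastNet.DecidableInPolyTime BroadcastNet.Instance.encode
      BroadcastNet.Instance.FairLive := by
  -- The function is the classical truth value of the question; the content lies in the machine that
  -- computes it.
  exact ⟨fun x => TableProg.bit (BroadcastNet.Instance.FairLive x),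
    fun x => TableProg.bit_eq_true, TableProg.polyTime_of_run _ _ FairDecider.decide .inp
      FairDecider.Reg.idle (fun v => v.b₁) FairDecider.run_decide⟩
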